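/- **Setting.** Let $L>0$, let $\kappa,n\neq 0$ be real constants and consider on $[0,L]\times(-w/2,w/2)$ the reference forms $$a(z_1,z_2)=\begin{pmatrix}(1-\kappa z_2)^2&0\\0&1\end{pmatrix},\qquad \mathrm{II}=\mathrm{II}^0=\begin{pmatrix}0&0\\0&n\end{pmatrix}.$$ *Energy density.* Let $\mathcal W:\mathbb R^{3\times3}\to[0,\infty]$ be continuous with $\mathcal W(RA)=\mathcal W(A)$ for all $R\in SO(3)$; $\mathcal W(A)=0$ iff $A\in SO(3)$; $\mathcal W(A)\ge c\,\mathrm{dist}^2(A,SO(3))$ for some $c>0$; and $\mathcal W$ finite and $C^2$ in a neighborhood of $SO(3)$. Put $\mathcal Q_3(B)=\tfrac12D_I^2\mathcal W(B,B)$. *Associated Euclidean surface.* Let $(e_1,e_2,e_3)$ be the frame with $e_1'=\kappa e_2$, $e_2'=-\kappa e_1$, $e_3'=0$ and an arbitrary initial value in $SO(3)$, and let $\Phi(z_1,z_2)=\int_0^{z_1}e_1\,ds+z_2e_2+\tfrac12 n z_2^2e_3-\tfrac16 n^2z_2^3e_2$ (with $e_2,e_3$ evaluated at $z_1$), with unit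 normal $\tilde n=\partial_1\Phi\times\partial_2\Phi/|\partial_1\Phi\times\partial_2\Phi|$. For small $w>0$ and $x=(x_1,x_2)\in S=(0,L)\times(-\tfrac12,\tfrac12)$ set $M=(\nabla\Phi\,|\,\tilde n)|_{(x_1,wx_2)}$, $$F_0=M^{-T}\,\mathrm{diag}\big((1-\kappa wx_2)^2,1,1\big)\,M^{-1},\qquad A_0=F_0^{1/2}M,$$ $$\mathcal Q_w(x,F)=\min\{\mathcal Q_3(A_0^{-T}GA_0^{-1}) : G\in\mathbb R^{3\times3},\ G_{2\times2}=F\},$$ where $G_{2\times2}$ is the upper left $2\times2$ block of $G$. *Rescaled isometries and plate energy.* Write $\nabla_w=(\partial_1\,|\,w^{-1}\partial_2)$. A rescaled isometry is a map $f\in W^{2,2}(S;\mathbb R^3)$ with $\nabla_wf^T\nabla_wf(x)=a(x_1,wx_2)$ for a.e. $x\in S$. Let $\nu_f$ be its unit normal, $(\mathrm{II}^w_f)_{ij}=(\nabla_w^2f)_{ij}\cdot\nu_f$ its rescaled second fundamental form, $\mathrm{II}^w(x_1,x_2)=\mathrm{II}(x_1,wx_2)$, and $$\tilde{\mathcal E}_w(f)=\frac1{12}\,\frac1{|S|}\int_S\mathcal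 Q_w\big(x,\mathrm{II}^w_f-\mathrm{II}^w\big)\,dx .$$ **Proposition.** The geometry $(a,\mathrm{II})$ satisfies $\mathrm{II}_{11}=0$ on the midline $z_2=0$ and is Codazzi-incompatible, i.e. on $[0,L]$ the Gauss deficit $\delta^G(z_1)=(\det\mathrm{II}-K)|_{(z_1,0)}$ ($K$ being the Gaussian curvature of $a$) vanishes identically, while the Codazzi deficit $$\delta^C(z_1)=\begin{pmatrix}\partial_2\mathrm{II}_{11}-\partial_1\mathrm{II}_{12}+\kappa(\mathrm{II}_{11}+\mathrm{II}_{22})\\ \partial_2\mathrm{II}_{12}-\partial_1\mathrm{II}_{22}-\kappa\,\mathrm{II}_{12}\end{pmatrix}\bigg|_{(z_1,0)}$$ does not. For every $\varepsilon>0$, $$\lim_{w\to0^+}\Big(\inf\frac1{w^{1+\varepsilon}}\tilde{\mathcal E}_w\Big)=\infty,$$ the infimum being over all rescaled isometries $f\in W^{2,2}(S;\mathbb R^3)$. Moreover, for every sequence $w_k\to0^+$, every sequence of rescaled isometries $f_k$ of width $w_k$ and every $\varepsilon>0$, $$\frac{w_k^{(1+\varepsilon)/2}}{\|\mathrm{II}^{w_k}_{f_k}-\mathrm{II}^0\|_{L^2(S)}}\longrightarrow0,\qquad\text{i.e.}\qquad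 \|\mathrm{II}^{w_k}_{f_k}-\mathrm{II}^0\|_{L^2(S)}\gg w_k^{(1+\varepsilon)/2}.$$ -/

import Mathlib

open MeasureTheory Set Filter Topology
open scoped ENNReal ContDiff Matrix

noncomputable section

namespace Ribbon

/-- Euclidean three-space. -/
abbrev E3 : Type := EuclideanSpace ℝ (Fin 3)

/-! ### Vectors in three-space -/

/-- The cross product of two vectors of Euclidean three-space. -/
def cross (a b : E3) : E3 := WithLp.toLp 2 (crossProduct (WithLp.ofLp a) (WithLp.ofLp b))

/-- The unit normal `(a × b) / |a × b|`. -/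
def unitNormal (a b : E3) : E3 := ‖cross a b‖⁻¹ • cross a b

/-- The matrix with columns `a`, `b`, `c`. -/
def colMatrix (a b c : E3) : Matrix (Fin 3) (Fin 3) ℝ :=
  !![a 0, b 0, c 0; a 1, b 1, c 1; a 2, b 2, c 2]

/-! ### Sobolev maps on the rescaled strip -/

/-- The rescaled strip `S = (0, L) × (-1/2, 1/2)`. -/
def strip (L : ℝ) : Set (ℝ × ℝ) := Ioo 0 L ×ˢ Ioo (-1 / 2) (1 / 2)

/-- The two coordinate directions of the plane. -/
def dir (i : Fin 2) : ℝ × ℝ := if i = 0 then (1, 0) else (0, 1)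

/-- `g` is the weak partial derivative of `f` in direction `i` on the open set `Ω`:
`∫_Ω ∂ᵢφ f = - ∫_Ω φ g` for every smooth `φ` with compact support in `Ω`
(used below only for square-integrable `f` and `g`). -/
def IsWeakPartial (Ω : Set (ℝ × ℝ)) (i : Fin 2) (f g : ℝ × ℝ → E3) : Prop :=
  ∀ φ : ℝ × ℝ → ℝ, ContDiff ℝ ∞ φ → HasCompactSupport φ → tsupport φ ⊆ Ω →
    ∫ x in Ω, (fderiv ℝ φ x (dir i)) • f x = - ∫ x in Ω, φ x • g x

/-- A map of class `W^{2,2}(S; ℝ³)`, given together with (representatives of) its weak first and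
second partial derivatives, which are determined by the map up to null sets.
Here `grad i = ∂ᵢ f` and `hess i j = ∂ⱼ ∂ᵢ f`. -/
structure W22 (L : ℝ) where
  toFun : ℝ × ℝ → E3
  grad : Fin 2 → ℝ × ℝ → E3
  hess : Fin 2 → Fin 2 → ℝ × ℝ → E3
  memLp_toFun : MemLp toFun 2 (volume.restrict (strip L))
  memLp_grad : ∀ i, MemLp (grad i) 2 (volume.restrict (strip L))
  memLp_hess : ∀ i j, MemLp (hess i j) 2 (volume.restrict (strip L))
  weak_grad : ∀ i, IsWeakPartial (strip L) i toFun (grad i)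
  weak_hess : ∀ i j, IsWeakPartial (strip L) j (grad i) (hess i j)

/-- The factors of the rescaled gradient `∇_w = (∂₁ | w⁻¹ ∂₂)`. -/
def scale (w : ℝ) (i : Fin 2) : ℝ := if i = 0 then 1 else w⁻¹

/-- The `i`-th column of the rescaled gradient `∇_w f`. -/
def W22.rgrad {L : ℝ} (f : W22 L) (w : ℝ) (i : Fin 2) (x : ℝ × ℝ) : E3 :=
  scale w i • f.grad i x

/-- The `(i, j)` entry of the rescaled Hessian `∇_w² f`. -/
def W22.rhess {L : ℝ} (f : W22 L) (w : ℝ) (i j : Fin 2) (x : ℝ × ℝ) : E3 :=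
  (scale w i * scale w j) • f.hess i j x

/-- The unit normal `ν_f` (for `w > 0` it does not depend on `w`). -/
def W22.normal {L : ℝ} (f : W22 L) (w : ℝ) (x : ℝ × ℝ) : E3 :=
  unitNormal (f.rgrad w 0 x) (f.rgrad w 1 x)

/-- The rescaled second fundamental form `(II^w_f)ᵢⱼ = (∇_w² f)ᵢⱼ · ν_f`. -/
def W22.secondForm {L : ℝ} (f : W22 L) (w : ℝ) (x : ℝ × ℝ) : Matrix (Fin 2) (Fin 2) ℝ :=
  Matrix.of fun i j => inner ℝ (f.rhess w i j x) (f.normal w x)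

/-! ### The reference geometry -/

/-- The reference metric `a(z₁, z₂) = diag((1 - κ z₂)², 1)`. -/
def refMetric (κ : ℝ) (z : ℝ × ℝ) : Matrix (Fin 2) (Fin 2) ℝ :=
  !![(1 - κ * z.2) ^ 2, 0; 0, 1]

/-- The reference second fundamental form `II(z₁, z₂) = diag(0, n)`. -/
def refSecond (n : ℝ) (_z : ℝ × ℝ) : Matrix (Fin 2) (Fin 2) ℝ := !![0, 0; 0, n]

/-- The Gaussian curvature `K = - ∂₂² √a₁₁ / √a₁₁` of a metric of the form
`a₁₁ dz₁² + dz₂²`. -/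
def gaussCurvature (a : ℝ × ℝ → Matrix (Fin 2) (Fin 2) ℝ) (z : ℝ × ℝ) : ℝ :=
  -(iteratedDeriv 2 (fun t => √(a (z.1, t) 0 0)) z.2) / √(a z 0 0)

/-- The Gauss deficit `det II - K` along the midline `z₂ = 0`. -/
def gaussDeficit (a II : ℝ × ℝ → Matrix (Fin 2) (Fin 2) ℝ) (s : ℝ) : ℝ :=
  (II (s, 0)).det - gaussCurvature a (s, 0)

/-- The Codazzi deficit along the midline `z₂ = 0` of geodesic curvature `κ`. -/
def codazziDeficit (κ : ℝ → ℝ) (II : ℝ × ℝ → Matrix (Fin 2) (Fin 2) ℝ) (s : ℝ) : Fin 2 → ℝ :=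
  ![deriv (fun t => II (s, t) 0 0) 0 - deriv (fun r => II (r, 0) 0 1) s
      + κ s * (II (s, 0) 0 0 + II (s, 0) 1 1),
    deriv (fun t => II (s, t) 0 1) 0 - deriv (fun r => II (r, 0) 1 1) s
      - κ s * II (s, 0) 0 1]

/-- A ribbon of length `L` is Codazzi-incompatible along its midline if its Gauss deficit vanishes
identically there and its Codazzi deficit does not. -/
def CodazziIncompatible (L : ℝ) (κ : ℝ → ℝ)
    (a II : ℝ × ℝ → Matrix (Fin 2) (Fin 2) ℝ) : Prop :=
  (∀ s ∈ Icc 0 L, gaussDeficit a II s = 0) ∧ ¬ ∀ s ∈ Icc 0 L, codazziDeficit κ II s = 0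

/-- A rescaled isometric immersion of width `w`: `∇_w fᵀ ∇_w f (x) = a(x₁, w x₂)` for a.e. `x`. -/
def IsRescaledIsometry {L : ℝ} (κ w : ℝ) (f : W22 L) : Prop :=
  ∀ᵐ x ∂(volume.restrict (strip L)), ∀ i j : Fin 2,
    inner ℝ (f.rgrad w i x) (f.rgrad w j x) = refMetric κ (x.1, w * x.2) i j

/-- The norm `‖II^w_f - II⁰‖` in `L²(S)`, where `II⁰(x₁) = II(x₁, 0)` is the reference form on the
midline and matrices carry the Frobenius norm. -/
def secondFormDist {L : ℝ} (n w : ℝ) (f : W22 L) : ℝ≥0∞ :=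
  (∫⁻ x in strip L, ENNReal.ofReal
    (∑ i, ∑ j, (f.secondForm w x i j - refSecond n (x.1, 0) i j) ^ 2)) ^ (1 / 2 : ℝ)

/-! ### The associated Euclidean ribbon -/

/-- The Darboux frame `(e₁, e₂, e₃)` along the midline, for geodesic curvature `κ`, normal curvature
`II₁₁ = 0` and relative torsion `II₁₂ = 0`, whose initial value is given by the columns of `R`;
see `hasDerivAt_frame` and `frame_zero`. -/
def frame (κ : ℝ) (R : Matrix (Fin 3) (Fin 3) ℝ) (s : ℝ) : Fin 3 → E3 :=
  ![Real.cos (κ * s) • WithLp.toLp 2 (R.col 0) + Real.sin (κ * s) • WithLp.toLp 2 (R.col 1),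
    -Real.sin (κ * s) • WithLp.toLp 2 (R.col 0) + Real.cos (κ * s) • WithLp.toLp 2 (R.col 1),
    WithLp.toLp 2 (R.col 2)]

theorem frame_zero (κ : ℝ) (R : Matrix (Fin 3) (Fin 3) ℝ) (i : Fin 3) :
    frame κ R 0 i = WithLp.toLp 2 (R.col i) := by
  fin_cases i <;> simp [frame]

/-- The Darboux frame equations with `II₁₁ = II₁₂ = 0`. -/
theorem hasDerivAt_frame (κ n : ℝ) (R : Matrix (Fin 3) (Fin 3) ℝ) (s : ℝ) :
    HasDerivAt (fun r => frame κ R r 0)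
      (κ • frame κ R s 1 + refSecond n (s, 0) 0 0 • frame κ R s 2) s ∧
    HasDerivAt (fun r => frame κ R r 1)
      (-κ • frame κ R s 0 + refSecond n (s, 0) 0 1 • frame κ R s 2) s ∧
    HasDerivAt (fun r => frame κ R r 2)
      (-refSecond n (s, 0) 0 0 • frame κ R s 0 - refSecond n (s, 0) 0 1 • frame κ R s 1) s := by
  have hl : HasDerivAt (fun r : ℝ => κ * r) κ s := by
    simpa using (hasDerivAt_id s).const_mul κ
  refine ⟨?_, ?_, ?_⟩
  · have := (hl.cos.smul_const (WithLp.toLp 2 (R.col 0) : E3)).add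
      (hl.sin.smul_const (WithLp.toLp 2 (R.col 1) : E3))
    refine this.congr_deriv ?_
    simp only [frame, refSecond, Matrix.of_apply, Matrix.cons_val, smul_add, smul_smul]
    module
  · have := (hl.sin.neg.smul_const (WithLp.toLp 2 (R.col 0) : E3)).add
      (hl.cos.smul_const (WithLp.toLp 2 (R.col 1) : E3))
    refine this.congr_deriv ?_
    simp only [frame, refSecond, Matrix.of_apply, Matrix.cons_val, smul_add, smul_smul]
    module
  · refine (hasDerivAt_const s (WithLp.toLp 2 (R.col 2) : E3)).congr_deriv ?_
    simp [refSecond]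

/-- The mid-surface of the Euclidean ribbon associated with the reference geometry,
`Φ(z₁, z₂) = ∫₀^{z₁} e₁ + z₂ e₂ + ½ z₂² II⁰₂₂ e₃ - ⅙ z₂³ II⁰₂₂ (II⁰₁₂ e₁ + II⁰₂₂ e₂)`. -/
def midSurface (κ n : ℝ) (R : Matrix (Fin 3) (Fin 3) ℝ) (z : ℝ × ℝ) : E3 :=
  (∫ s in (0 : ℝ)..z.1, frame κ R s 0) + z.2 • frame κ R z.1 1
    + (1 / 2 * z.2 ^ 2 * refSecond n (z.1, 0) 1 1) • frame κ R z.1 2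
    - (1 / 6 * z.2 ^ 3 * refSecond n (z.1, 0) 1 1) •
        (refSecond n (z.1, 0) 0 1 • frame κ R z.1 0 + refSecond n (z.1, 0) 1 1 • frame κ R z.1 1)

/-- The matrix `(∂₁Φ | ∂₂Φ | ñ)` at `z`, where `ñ` is the unit normal of `Φ`. -/
def midFrame (κ n : ℝ) (R : Matrix (Fin 3) (Fin 3) ℝ) (z : ℝ × ℝ) : Matrix (Fin 3) (Fin 3) ℝ :=
  let d1 : E3 := deriv (fun s => midSurface κ n R (s, z.2)) z.1
  let d2 : E3 := deriv (fun t => midSurface κ n R (z.1, t)) z.2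
  colMatrix d1 d2 (unitNormal d1 d2)

/-- The three-dimensional metric on the mid-surface, the block matrix `diag(a, 1)`. -/
def blockMetric (κ : ℝ) (z : ℝ × ℝ) : Matrix (Fin 3) (Fin 3) ℝ :=
  !![refMetric κ z 0 0, refMetric κ z 0 1, 0;
     refMetric κ z 1 0, refMetric κ z 1 1, 0;
     0, 0, 1]

/-- `F₀ = (∇Φ | ñ)⁻ᵀ diag(a, 1) (∇Φ | ñ)⁻¹` at `(x₁, w x₂)`. -/
def prestrainSq (κ n : ℝ) (R : Matrix (Fin 3) (Fin 3) ℝ) (w : ℝ) (x : ℝ × ℝ) :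
    Matrix (Fin 3) (Fin 3) ℝ :=
  ((midFrame κ n R (x.1, w * x.2))⁻¹)ᵀ * blockMetric κ (x.1, w * x.2)
    * (midFrame κ n R (x.1, w * x.2))⁻¹

/-- `A₀ = F₀^{1/2} (∇Φ | ñ)` at `(x₁, w x₂)`; the square root of the positive semidefinite matrix
`F₀` is given by the functional calculus of symmetric matrices. -/
def prestrain (κ n : ℝ) (R : Matrix (Fin 3) (Fin 3) ℝ) (w : ℝ) (x : ℝ × ℝ) :
    Matrix (Fin 3) (Fin 3) ℝ :=
  cfc Real.sqrt (prestrainSq κ n R w x) * midFrame κ n R (x.1, w * x.2)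

/-! ### The energy density and the plate energy -/

section Density

attribute [local instance] Matrix.frobeniusNormedAddCommGroup Matrix.frobeniusNormedSpace

/-- The rotations `SO(3)`, as a set of matrices. -/
def rotations : Set (Matrix (Fin 3) (Fin 3) ℝ) :=
  (Matrix.specialOrthogonalGroup (Fin 3) ℝ : Set (Matrix (Fin 3) (Fin 3) ℝ))

/-- The standing assumptions on an elastic energy density `𝒲 : ℝ^{3×3} → [0, ∞]`: it is continuous,
frame-indifferent, vanishes exactly on `SO(3)`, is coercive, and is (finite and) of class `C²` in a
neighborhood of `SO(3)`. Matrices carry the Frobenius norm. -/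
structure IsEnergyDensity (𝒲 : Matrix (Fin 3) (Fin 3) ℝ → ℝ≥0∞) : Prop where
  continuous : Continuous 𝒲
  frame_indifferent : ∀ R ∈ rotations, ∀ A, 𝒲 (R * A) = 𝒲 A
  eq_zero_iff : ∀ A, 𝒲 A = 0 ↔ A ∈ rotations
  coercive : ∃ c : ℝ, 0 < c ∧ ∀ A, ENNReal.ofReal (c * Metric.infDist A rotations ^ 2) ≤ 𝒲 A
  regular : ∃ U : Set (Matrix (Fin 3) (Fin 3) ℝ), IsOpen U ∧ rotations ⊆ U ∧
    (∀ A ∈ U, 𝒲 A ≠ ⊤) ∧ ContDiffOn ℝ 2 (fun A => (𝒲 A).toReal) U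

/-- The quadratic form `𝒬₃(B) = ½ D²_I 𝒲 (B, B)`. -/
def Q3 (𝒲 : Matrix (Fin 3) (Fin 3) ℝ → ℝ≥0∞) (B : Matrix (Fin 3) (Fin 3) ℝ) : ℝ :=
  1 / 2 * iteratedFDeriv ℝ 2 (fun A => (𝒲 A).toReal) 1 ![B, B]

end Density

/-- The quadratic form `𝒬_w(x, F) = min {𝒬₃(A₀⁻ᵀ G A₀⁻¹) : G ∈ ℝ^{3×3}, G_{2×2} = F}`, where
`G_{2×2}` is the upper left `2 × 2` block of `G` (`𝒬₃` being a nonnegative quadratic form, the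
infimum is attained). -/
def plateForm (𝒲 : Matrix (Fin 3) (Fin 3) ℝ → ℝ≥0∞) (κ n : ℝ) (R : Matrix (Fin 3) (Fin 3) ℝ)
    (w : ℝ) (x : ℝ × ℝ) (F : Matrix (Fin 2) (Fin 2) ℝ) : ℝ :=
  sInf ((fun G : Matrix (Fin 3) (Fin 3) ℝ =>
      Q3 𝒲 (((prestrain κ n R w x)⁻¹)ᵀ * G * (prestrain κ n R w x)⁻¹)) ''
    {G | G.submatrix Fin.castSucc Fin.castSucc = F})

/-- The plate energy `Ẽ_w(f) = (1/12) ⨍_S 𝒬_w(x, II^w_f - II^w) dx`, where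
`II^w(x₁, x₂) = II(x₁, w x₂)`. -/
def plateEnergy {L : ℝ} (𝒲 : Matrix (Fin 3) (Fin 3) ℝ → ℝ≥0∞) (κ n : ℝ)
    (R : Matrix (Fin 3) (Fin 3) ℝ) (w : ℝ) (f : W22 L) : ℝ≥0∞ :=
  1 / 12 * ⨍⁻ x in strip L, ENNReal.ofReal
    (plateForm 𝒲 κ n R w x (f.secondForm w x - refSecond n (x.1, w * x.2))) ∂volume

end Ribbon

end

open Ribbon

/-! The metric is flat, so every rescaled isometry `f` satisfies Gauss's equation `det II = 0`,
together with the Codazzi equations. Write `II - II⁰` with entries `a = II₁₁`, `b = II₁₂`, `c = II₂₂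
- n`, let `D` be its squared Frobenius norm, and put `g = 1 - κ w x₂`. Testing the first Codazzi
equation with a fixed bump `φ` gives `∫ φ (2κ II₁₁ + κ g² II₂₂) = -∫ g (∂₁φ II₁₂ - w⁻¹ ∂₂φ II₁₁)`.
If `II` were close to `diag(0, n)`, the left side would be close to `κ n ∫ φ ≠ 0`, so the right side
cannot be small. Its only dangerous term carries the factor `w⁻¹`, but there Gauss's equation helps:
`n a = b² - a c`, hence `|a| ≤ D / |n|` is quadratic in the distance. Therefore `w⁻¹ ∫ D` is bounded
below, i.e. `∫ D ≥ c w` (`exists_le_integral_deficit`). Both limits follow on dividing by powers of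
`w`, the first one after bounding the plate energy below by `∫ D`.

Two points need work. Since `f` is only of class `W^{2,2}`, the Gauss and Codazzi equations are
derived weakly (`W22.det_secondForm`, `W22.codazzi`) from the divergence form of Jacobians, which
involves no third derivatives of `f`. The energy controls `D` because `𝒬₃` is coercive on symmetric
parts and the prestrain `A₀` is invertible and bounded near the midline
(`IsEnergyDensity.exists_le_plateForm`). -/

namespace Ribbon

/-! ### Mollification and weak approximation of Sobolev functions -/

section Sobolev

set_option linter.unusedSectionVars false

variable {E : Type*} [NormedAddCommGroup E] [NormedSpace ℝ E] [FiniteDimensional ℝ E]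
  [MeasurableSpace E] [BorelSpace E] {μ : Measure E}

/-- The pairing of an `L²` function with the translates of another one is continuous. -/
theorem continuous_integral_translate_mul [μ.IsAddHaarMeasure] {u h : E → ℝ} (hu : MemLp u 2 μ)
    (hh : MemLp h 2 μ) : Continuous fun y => ∫ x, h x * u (y + x) ∂μ := by
  -- Seen as an inner product in `L²`, the integral inherits its continuity from the strong
  -- continuity of translations.
  have key : ∀ y : E, ∫ x, h x * u (y + x) ∂μ
      = inner ℝ ((DomAddAct.mk y) +ᵥ hu.toLp u) (hh.toLp h) := by
    intro y
    rw [DomAddAct.mk_vadd_toLp, L2.inner_def]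
    refine integral_congr_ae ?_
    filter_upwards [hh.coeFn_toLp, MemLp.coeFn_toLp (hu.comp_measurePreserving
      (measurePreserving_vadd y μ))] with x h1 h2
    have h3 : inner ℝ ((u ∘ fun x => y +ᵥ x) x) (h x) = h x * u (y + x) := by simp
    rw [h1, ← h3, ← h2]
    rfl
  simp_rw [key]
  have : Fact ((2 : ℝ≥0∞) ≠ ⊤) := ⟨by simp⟩
  have h1 : Continuous fun y : E => (DomAddAct.mk y) +ᵥ hu.toLp u := by
    have : Continuous fun y : E => (DomAddAct.mk y : Eᵈᵃᵃ) := DomAddAct.continuous_mk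
    exact this.vadd continuous_const
  exact h1.inner continuous_const

/-- The mollification of `u` by the normalised bump function of `ρ`. -/
noncomputable def mollify (μ : Measure E) (ρ : ContDiffBump (0 : E)) (u : E → ℝ) : E → ℝ :=
  convolution u (ρ.normed μ) (ContinuousLinearMap.mul ℝ ℝ) μ

theorem contDiff_mollify [μ.IsAddHaarMeasure] (ρ : ContDiffBump (0 : E)) {u : E → ℝ}
    (hu : Integrable u μ) : ContDiff ℝ ∞ (mollify μ ρ u) :=
  ρ.hasCompactSupport_normed.contDiff_convolution_right _ hu.locallyIntegrable
    ρ.contDiff_normed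

theorem fderiv_mollify [μ.IsAddHaarMeasure] (ρ : ContDiffBump (0 : E)) {u : E → ℝ}
    (hu : Integrable u μ) (x d : E) :
    fderiv ℝ (mollify μ ρ u) x d = ∫ t, u t * fderiv ℝ (ρ.normed μ) (x - t) d ∂μ := by
  have h1 : ContDiff ℝ 1 (ρ.normed μ) := ρ.contDiff_normed (n := 1)
  have := ρ.hasCompactSupport_normed.hasFDerivAt_convolution_right
    (ContinuousLinearMap.mul ℝ ℝ) (μ := μ) hu.locallyIntegrable h1 x
  rw [mollify, this.fderiv, convolution_precompR_apply _ hu.locallyIntegrable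
    (ρ.hasCompactSupport_normed.fderiv ℝ) (h1.continuous_fderiv (by simp))]
  rfl

/-- Mollifications converge weakly in `L²`. -/
theorem tendsto_integral_mul_mollify [μ.IsAddHaarMeasure] {u h : E → ℝ} (hu : MemLp u 2 μ)
    (hh : MemLp h 2 μ) (hu1 : Integrable u μ) (hh1 : Integrable h μ)
    {ρ : ℕ → ContDiffBump (0 : E)} (hρ : Tendsto (fun k => (ρ k).rOut) atTop (𝓝 0)) :
    Tendsto (fun k => ∫ x, mollify μ (ρ k) u x * h x ∂μ) atTop (𝓝 (∫ x, u x * h x ∂μ)) := by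
  -- By Fubini, pairing `h` with the mollified `u` is the same as mollifying the correlation `G` at
  -- `0`. As `G` is continuous, the approximate identity converges to `G 0`.
  set G : E → ℝ := fun y => ∫ x, h x * u (y + x) ∂μ with hG
  have hGc : Continuous G := continuous_integral_translate_mul hu hh
  have h0 : G 0 = ∫ x, u x * h x ∂μ := by simp [hG, mul_comm]
  rw [← h0]
  refine (ContDiffBump.convolution_tendsto_right_of_continuous (μ := μ) hρ hGc 0).congr
    fun k => ?_
  rw [convolution_def]
  have hmol : ∀ x, mollify μ (ρ k) u x = ∫ y, (ρ k).normed μ y * u (x - y) ∂μ := by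
    intro x
    rw [mollify, convolution_eq_swap]
    simp [mul_comm]
  have hint : Integrable (fun p : E × E => (ρ k).normed μ p.1 * (h p.2 * u (-(p.1 - p.2))))
      (μ.prod μ) := by
    obtain ⟨C, hC⟩ := (ρ k).hasCompactSupport_normed.exists_bound_of_continuous
      ((ρ k).continuous_normed (μ := μ))
    refine Integrable.bdd_mul (c := C)
      (hh1.convolution_integrand (ContinuousLinearMap.mul ℝ ℝ) hu1.comp_neg) ?_ ?_
    · exact ((ρ k).continuous_normed.comp continuous_fst).aestronglyMeasurable
    · exact Eventually.of_forall fun p => hC p.1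
  calc ∫ t, ContinuousLinearMap.lsmul ℝ ℝ ((ρ k).normed μ t) (G (0 - t)) ∂μ
      = ∫ t, ∫ x, (ρ k).normed μ t * (h x * u (-(t - x))) ∂μ ∂μ := by
        refine integral_congr_ae (Eventually.of_forall fun t => ?_)
        simp only [hG, ContinuousLinearMap.lsmul_apply, smul_eq_mul, integral_const_mul]
        congr 2 with x
        congr 2; abel
    _ = ∫ x, ∫ t, (ρ k).normed μ t * (h x * u (-(t - x))) ∂μ ∂μ := integral_integral_swap hint
    _ = _ := by
        refine integral_congr_ae (Eventually.of_forall fun x => ?_)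
        simp only [hmol]
        rw [← integral_mul_const]
        congr 1 with t
        rw [neg_sub]; ring

/-- `u'` is the weak derivative of `u` in the direction `d` on the open set `Ω`. -/
def IsWeakDirDeriv (μ : Measure E) (Ω : Set E) (d : E) (u u' : E → ℝ) : Prop :=
  ∀ φ : E → ℝ, ContDiff ℝ ∞ φ → HasCompactSupport φ → tsupport φ ⊆ Ω →
    ∫ x in Ω, fderiv ℝ φ x d * u x ∂μ = -∫ x in Ω, φ x * u' x ∂μ

variable {Ω : Set E} {d e : E} {u u' v v' : E → ℝ}

theorem memLp_indicator_of_restrict (hΩ : IsOpen Ω) {p : ℝ≥0∞} (hu : MemLp u p (μ.restrict Ω)) :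
    MemLp (Ω.indicator u) p μ :=
  (memLp_indicator_iff_restrict hΩ.measurableSet).2 hu

/-- The reflected bump `t ↦ ρ (x - t)` is an admissible test function once the closed ball about `x`
lies in `Ω`. The sign from the reflection cancels the one from integration by parts. -/
theorem IsWeakDirDeriv.fderiv_mollify [μ.IsAddHaarMeasure] (hΩ : IsOpen Ω)
    (h : IsWeakDirDeriv μ Ω d u u') (hu : IntegrableOn u Ω μ)
    {ρ : ContDiffBump (0 : E)} {x : E}
    (hx : Metric.closedBall x ρ.rOut ⊆ Ω) :
    fderiv ℝ (mollify μ ρ (Ω.indicator u)) x d = mollify μ ρ (Ω.indicator u') x := by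
  rw [Ribbon.fderiv_mollify ρ (hu.integrable_indicator hΩ.measurableSet)]
  set φ : E → ℝ := fun t => ρ.normed μ (x - t) with hφ
  have hφc : ContDiff ℝ ∞ φ := (ρ.contDiff_normed (n := ⊤)).comp (contDiff_const.sub contDiff_id)
  have hts : tsupport φ ⊆ Metric.closedBall x ρ.rOut := by
    refine closure_minimal (fun t ht => ?_) Metric.isClosed_closedBall
    have h2 : x - t ∈ Function.support (ρ.normed μ) := ht
    rw [ρ.support_normed_eq] at h2
    rw [Metric.mem_closedBall, dist_comm, dist_eq_norm]
    simpa using (mem_ball_zero_iff.1 h2).le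
  have hcs : HasCompactSupport φ :=
    HasCompactSupport.of_support_subset_isCompact (isCompact_closedBall x ρ.rOut)
      ((subset_tsupport φ).trans hts)
  have hder : ∀ t, fderiv ℝ φ t d = - fderiv ℝ (ρ.normed μ) (x - t) d := by
    intro t
    have h1 : HasFDerivAt (ρ.normed μ) (fderiv ℝ (ρ.normed μ) (x - t)) (x - t) :=
      ((ρ.contDiff_normed (n := 1)).differentiable (by simp) _).hasFDerivAt
    have h2 : HasFDerivAt (fun t : E => x - t) (-ContinuousLinearMap.id ℝ E) t :=
      (hasFDerivAt_id t).const_sub x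
    have h3 : HasFDerivAt φ _ t := h1.comp t h2
    rw [h3.fderiv]
    simp
  have key := h φ hφc hcs (hts.trans hx)
  have e1 : ∫ t, Ω.indicator u t * fderiv ℝ (ρ.normed μ) (x - t) d ∂μ
      = -∫ t in Ω, fderiv ℝ φ t d * u t ∂μ := by
    rw [← integral_neg, ← integral_indicator hΩ.measurableSet]
    congr 1 with t
    by_cases ht : t ∈ Ω <;> simp [ht, hder, mul_comm]
  rw [e1, key, neg_neg, ← integral_indicator hΩ.measurableSet, mollify, convolution_def]
  congr 1 with t
  by_cases ht : t ∈ Ω <;> simp [ht, hφ, mul_comm]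

/-- A Sobolev function is a weak limit, together with its derivatives, of smooth functions. -/
theorem exists_smooth_weak_approx [μ.IsAddHaarMeasure] [IsFiniteMeasure (μ.restrict Ω)]
    (hΩ : IsOpen Ω) {K : Set E} (hK : IsCompact K) (hKΩ : K ⊆ Ω) (hu : MemLp u 2 (μ.restrict Ω)) :
    ∃ U : ℕ → E → ℝ, (∀ k, ContDiff ℝ ∞ (U k)) ∧
      (∀ h, MemLp h 2 (μ.restrict Ω) →
        Tendsto (fun k => ∫ x in Ω, U k x * h x ∂μ) atTop (𝓝 (∫ x in Ω, u x * h x ∂μ))) ∧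
      ∀ d u', IsWeakDirDeriv μ Ω d u u' → MemLp u' 2 (μ.restrict Ω) →
        ∀ h, MemLp h 2 (μ.restrict Ω) → (∀ x ∉ K, h x = 0) →
          Tendsto (fun k => ∫ x in Ω, fderiv ℝ (U k) x d * h x ∂μ) atTop
            (𝓝 (∫ x in Ω, u' x * h x ∂μ)) := by
  obtain ⟨δ, hδ, hδΩ⟩ := hK.exists_cthickening_subset_open hΩ hKΩ
  have hpos : ∀ k : ℕ, (0 : ℝ) < 1 / ((k : ℝ) + 1) := fun k => by positivity
  let ρ : ℕ → ContDiffBump (0 : E) := fun k =>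
    ⟨1 / ((k : ℝ) + 1) / 2, 1 / ((k : ℝ) + 1), half_pos (hpos k), half_lt_self (hpos k)⟩
  have hρ : Tendsto (fun k => (ρ k).rOut) atTop (𝓝 0) := tendsto_one_div_add_atTop_nhds_zero_nat
  have hint : ∀ v : E → ℝ, MemLp v 2 (μ.restrict Ω) → Integrable (Ω.indicator v) μ := fun v hv =>
    IntegrableOn.integrable_indicator (hv.integrable one_le_two) hΩ.measurableSet
  have conv : ∀ v h : E → ℝ, MemLp v 2 (μ.restrict Ω) → MemLp h 2 (μ.restrict Ω) →
      Tendsto (fun k => ∫ x in Ω, mollify μ (ρ k) (Ω.indicator v) x * h x ∂μ) atTop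
        (𝓝 (∫ x in Ω, v x * h x ∂μ)) := by
    intro v h hv hh
    have := tendsto_integral_mul_mollify (memLp_indicator_of_restrict hΩ hv)
      (memLp_indicator_of_restrict hΩ hh) (hint v hv) (hint h hh) hρ
    convert this using 1
    · ext k
      rw [← integral_indicator hΩ.measurableSet]
      congr 1 with x
      by_cases hx : x ∈ Ω <;> simp [hx]
    · rw [← integral_indicator hΩ.measurableSet]
      congr 2 with x
      by_cases hx : x ∈ Ω <;> simp [hx]
  refine ⟨fun k => mollify μ (ρ k) (Ω.indicator u), fun k => contDiff_mollify _ (hint u hu),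
    fun h hh => conv u h hu hh, fun d u' hd hu' h hh hK0 => ?_⟩
  refine (conv u' h hu' hh).congr' ?_
  -- Once the radius is below `δ`, balls about points of `K` stay in `Ω` and differentiation
  -- commutes with mollification there. Off `K` the factor `h` vanishes.
  filter_upwards [hρ.eventually (gt_mem_nhds hδ)] with k hk
  refine integral_congr_ae (Eventually.of_forall fun x => ?_)
  by_cases hx : x ∈ K
  · have hb : Metric.closedBall x (ρ k).rOut ⊆ Ω :=
      (Metric.closedBall_subset_closedBall hk.le).trans
        ((Metric.closedBall_subset_cthickening hx δ).trans hδΩ)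
    simp only
    rw [hd.fderiv_mollify hΩ (hu.integrable one_le_two) hb]
  · simp [hK0 x hx]

/-! ### Calculus of weak derivatives: products, Jacobians, uniqueness -/

section Lemmas

theorem memLp_mul_of_continuous [IsFiniteMeasure (μ.restrict Ω)] {φ : E → ℝ} (hφ : Continuous φ)
    (hφc : HasCompactSupport φ) (hu : MemLp u 2 (μ.restrict Ω)) :
    MemLp (fun x => φ x * u x) 2 (μ.restrict Ω) := by
  obtain ⟨C, hC⟩ := hφc.exists_bound_of_continuous hφ
  exact hu.mul' (memLp_top_of_bound hφ.aestronglyMeasurable C (Eventually.of_forall hC))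

theorem integrable_mul_of_continuous [IsFiniteMeasure (μ.restrict Ω)] {φ : E → ℝ}
    (hφ : Continuous φ) (hφc : HasCompactSupport φ) (hu : MemLp u 2 (μ.restrict Ω)) :
    Integrable (fun x => φ x * u x) (μ.restrict Ω) :=
  (memLp_mul_of_continuous hφ hφc hu).integrable one_le_two

theorem fderiv_mul_dir {φ ψ : E → ℝ} (hφ : ContDiff ℝ ∞ φ) (hψ : ContDiff ℝ ∞ ψ) (x d : E) :
    fderiv ℝ (fun y => φ y * ψ y) x d = fderiv ℝ φ x d * ψ x + φ x * fderiv ℝ ψ x d := by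
  rw [fderiv_fun_mul (hφ.differentiable (by simp) x) (hψ.differentiable (by simp) x)]
  simp [mul_comm, add_comm]

theorem contDiff_fderiv_dir {φ : E → ℝ} (hφ : ContDiff ℝ ∞ φ) (d : E) :
    ContDiff ℝ ∞ fun x => fderiv ℝ φ x d :=
  (hφ.fderiv_right (m := ∞) (by simp)).clm_apply contDiff_const

theorem hasCompactSupport_fderiv_dir {φ : E → ℝ} (hφ : HasCompactSupport φ) (d : E) :
    HasCompactSupport fun x => fderiv ℝ φ x d := hφ.fderiv_apply ℝ d

theorem tsupport_fderiv_dir {φ : E → ℝ} (d : E) :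
    tsupport (fun x => fderiv ℝ φ x d) ⊆ tsupport φ := tsupport_fderiv_apply_subset ℝ d

/-- The product rule for Sobolev functions. -/
theorem IsWeakDirDeriv.mul [μ.IsAddHaarMeasure] [IsFiniteMeasure (μ.restrict Ω)] (hΩ : IsOpen Ω)
    (h1 : IsWeakDirDeriv μ Ω d u u') (h2 : IsWeakDirDeriv μ Ω d v v')
    (hu : MemLp u 2 (μ.restrict Ω)) (hu' : MemLp u' 2 (μ.restrict Ω))
    (hv : MemLp v 2 (μ.restrict Ω)) (hv' : MemLp v' 2 (μ.restrict Ω)) :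
    IsWeakDirDeriv μ Ω d (fun x => u x * v x) (fun x => u' x * v x + u x * v' x) := by
  intro φ hφ hφc hφΩ
  obtain ⟨U, hU, hU1, hU2⟩ := exists_smooth_weak_approx hΩ hφc.isCompact hφΩ hu
  have hd := contDiff_fderiv_dir hφ d
  have hdc := hasCompactSupport_fderiv_dir hφc d
  have m1 := memLp_mul_of_continuous hd.continuous hdc hv
  have m2 := memLp_mul_of_continuous hφ.continuous hφc hv
  have m3 := memLp_mul_of_continuous hφ.continuous hφc hv'
  have t1 := hU1 _ m1
  have t2 := hU2 d u' h1 hu' _ m2 fun x hx => by simp [image_eq_zero_of_notMem_tsupport hx]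
  have t3 := hU1 _ m3
  -- Only `u` is smoothed: `φ U_k` is then a test function for `v`, and as every term is linear in
  -- `U_k`, weak convergence is enough for the limit.
  have id1 : ∀ k, ∫ x in Ω, U k x * (fderiv ℝ φ x d * v x) ∂μ
      = -((∫ x in Ω, fderiv ℝ (U k) x d * (φ x * v x) ∂μ)
        + ∫ x in Ω, U k x * (φ x * v' x) ∂μ) := by
    intro k
    have hc1 : HasCompactSupport fun x => φ x * U k x := hφc.mul_right
    have key := h2 (fun x => φ x * U k x) (hφ.mul (hU k)) hc1
      ((tsupport_mul_subset_left).trans hφΩ)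
    simp_rw [fderiv_mul_dir hφ (hU k), add_mul] at key
    rw [integral_add] at key
    · have e1 : ∫ x in Ω, fderiv ℝ φ x d * U k x * v x ∂μ
          = ∫ x in Ω, U k x * (fderiv ℝ φ x d * v x) ∂μ := by congr 1 with x; ring
      have e2 : ∫ x in Ω, φ x * fderiv ℝ (U k) x d * v x ∂μ
          = ∫ x in Ω, fderiv ℝ (U k) x d * (φ x * v x) ∂μ := by congr 1 with x; ring
      have e3 : ∫ x in Ω, φ x * U k x * v' x ∂μ
          = ∫ x in Ω, U k x * (φ x * v' x) ∂μ := by congr 1 with x; ring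
      rw [e1, e2, e3] at key
      linarith
    · exact integrable_mul_of_continuous (hd.continuous.mul (hU k).continuous) hdc.mul_right hv
    · exact integrable_mul_of_continuous
        (hφ.continuous.mul (contDiff_fderiv_dir (hU k) d).continuous) hφc.mul_right hv
  have lim := tendsto_nhds_unique t1 ((t2.add t3).neg.congr fun k => (id1 k).symm)
  have i1 : Integrable (fun x => u' x * (φ x * v x)) (μ.restrict Ω) := hu'.integrable_mul m2
  have i2 : Integrable (fun x => u x * (φ x * v' x)) (μ.restrict Ω) := hu.integrable_mul m3
  rw [← integral_add i1 i2] at lim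
  calc _ = ∫ x in Ω, u x * (fderiv ℝ φ x d * v x) ∂μ := by congr 1 with x; ring
    _ = _ := lim
    _ = _ := by congr 2 with x; ring

theorem fderiv_fderiv_comm {φ : E → ℝ} (hφ : ContDiff ℝ ∞ φ) (x d e : E) :
    fderiv ℝ (fun y => fderiv ℝ φ y d) x e = fderiv ℝ (fun y => fderiv ℝ φ y e) x d := by
  have hd : DifferentiableAt ℝ (fderiv ℝ φ) x :=
    ((hφ.fderiv_right (m := ∞) (by simp)).differentiable (by simp)) x
  have hs : IsSymmSndFDerivAt ℝ φ x := hφ.contDiffAt.isSymmSndFDerivAt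
    (by simpa using (WithTop.coe_le_coe.2 le_top : ((2 : ℕ∞) : WithTop ℕ∞) ≤ ((⊤ : ℕ∞) : WithTop ℕ∞)))
  rw [fderiv_clm_apply hd (differentiableAt_const d), fderiv_clm_apply hd (differentiableAt_const e)]
  simpa using hs e d

/-- The Jacobian determinant of two Sobolev functions is a divergence. -/
theorem IsWeakDirDeriv.integral_mul_jacobian [μ.IsAddHaarMeasure] [IsFiniteMeasure (μ.restrict Ω)]
    {ud ue vd ve : E → ℝ} (hΩ : IsOpen Ω)
    (hud : IsWeakDirDeriv μ Ω d u ud) (hue : IsWeakDirDeriv μ Ω e u ue)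
    (hvd : IsWeakDirDeriv μ Ω d v vd) (hve : IsWeakDirDeriv μ Ω e v ve)
    (lu : MemLp u 2 (μ.restrict Ω)) (lud : MemLp ud 2 (μ.restrict Ω))
    (lue : MemLp ue 2 (μ.restrict Ω)) (lvd : MemLp vd 2 (μ.restrict Ω))
    (lve : MemLp ve 2 (μ.restrict Ω)) {φ : E → ℝ} (hφ : ContDiff ℝ ∞ φ)
    (hφc : HasCompactSupport φ) (hφΩ : tsupport φ ⊆ Ω) :
    ∫ x in Ω, φ x * (ud x * ve x - ue x * vd x) ∂μ
      = -∫ x in Ω, (fderiv ℝ φ x d * (u x * ve x) - fderiv ℝ φ x e * (u x * vd x)) ∂μ := by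
  obtain ⟨U, hU, hU1, hU2⟩ := exists_smooth_weak_approx hΩ hφc.isCompact hφΩ lu
  have hd := contDiff_fderiv_dir hφ d
  have hdc := hasCompactSupport_fderiv_dir hφc d
  have he := contDiff_fderiv_dir hφ e
  have hec := hasCompactSupport_fderiv_dir hφc e
  have m1 := memLp_mul_of_continuous hd.continuous hdc lve
  have m2 := memLp_mul_of_continuous hφ.continuous hφc lve
  have m3 := memLp_mul_of_continuous he.continuous hec lvd
  have m4 := memLp_mul_of_continuous hφ.continuous hφc lvd
  have t1 := hU1 _ m1
  have t2 := hU2 d ud hud lud _ m2 fun x hx => by simp [image_eq_zero_of_notMem_tsupport hx]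
  have t3 := hU1 _ m3
  have t4 := hU2 e ue hue lue _ m4 fun x hx => by simp [image_eq_zero_of_notMem_tsupport hx]
  -- Testing `v` with `∂_d (φ U_k)` and with `∂_e (φ U_k)` and using the symmetry of second
  -- derivatives of `φ U_k` removes `v` itself. No second derivative of `u` or `v` appears.
  have id1 : ∀ k, (∫ x in Ω, U k x * (fderiv ℝ φ x d * ve x) ∂μ)
      + (∫ x in Ω, fderiv ℝ (U k) x d * (φ x * ve x) ∂μ)
      = (∫ x in Ω, U k x * (fderiv ℝ φ x e * vd x) ∂μ)
        + ∫ x in Ω, fderiv ℝ (U k) x e * (φ x * vd x) ∂μ := by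
    intro k
    have hψ : ContDiff ℝ ∞ fun x => φ x * U k x := hφ.mul (hU k)
    have hψc : HasCompactSupport fun x => φ x * U k x := hφc.mul_right
    have hψΩ : tsupport (fun x => φ x * U k x) ⊆ Ω := (tsupport_mul_subset_left).trans hφΩ
    have k1 := hve _ (contDiff_fderiv_dir hψ d) (hasCompactSupport_fderiv_dir hψc d)
      ((tsupport_fderiv_dir d).trans hψΩ)
    have k2 := hvd _ (contDiff_fderiv_dir hψ e) (hasCompactSupport_fderiv_dir hψc e)
      ((tsupport_fderiv_dir e).trans hψΩ)
    simp_rw [fderiv_fderiv_comm hψ _ d e] at k1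
    have k3 := neg_injective (k1.symm.trans k2)
    have split : ∀ (a : E) (z : E → ℝ), MemLp z 2 (μ.restrict Ω) →
        ∫ x in Ω, fderiv ℝ (fun x => φ x * U k x) x a * z x ∂μ
          = (∫ x in Ω, U k x * (fderiv ℝ φ x a * z x) ∂μ)
            + ∫ x in Ω, fderiv ℝ (U k) x a * (φ x * z x) ∂μ := by
      intro a z hz
      rw [← integral_add]
      · congr 1 with x
        rw [fderiv_mul_dir hφ (hU k)]
        ring
      · refine (integrable_mul_of_continuous (((contDiff_fderiv_dir hφ a).continuous).mul
          (hU k).continuous) (hasCompactSupport_fderiv_dir hφc a).mul_right hz).congr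
          (Eventually.of_forall fun x => ?_)
        simp only [Pi.mul_apply]; ring
      · refine (integrable_mul_of_continuous (hφ.continuous.mul
          (contDiff_fderiv_dir (hU k) a).continuous) hφc.mul_right hz).congr
          (Eventually.of_forall fun x => ?_)
        simp only [Pi.mul_apply]; ring
    rw [split d ve lve, split e vd lvd] at k3
    exact k3
  have lim := tendsto_nhds_unique ((t1.add t2).congr id1) (t3.add t4)
  have i1 : Integrable (fun x => u x * (fderiv ℝ φ x d * ve x)) (μ.restrict Ω) :=
    lu.integrable_mul m1
  have i2 : Integrable (fun x => ud x * (φ x * ve x)) (μ.restrict Ω) := lud.integrable_mul m2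
  have i3 : Integrable (fun x => u x * (fderiv ℝ φ x e * vd x)) (μ.restrict Ω) :=
    lu.integrable_mul m3
  have i4 : Integrable (fun x => ue x * (φ x * vd x)) (μ.restrict Ω) := lue.integrable_mul m4
  have l1 : ∫ x in Ω, φ x * (ud x * ve x - ue x * vd x) ∂μ
      = (∫ x in Ω, ud x * (φ x * ve x) ∂μ) - ∫ x in Ω, ue x * (φ x * vd x) ∂μ := by
    rw [← integral_sub i2 i4]
    congr 1 with x; ring
  have l2 : ∫ x in Ω, (fderiv ℝ φ x d * (u x * ve x) - fderiv ℝ φ x e * (u x * vd x)) ∂μ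
      = (∫ x in Ω, u x * (fderiv ℝ φ x d * ve x) ∂μ)
        - ∫ x in Ω, u x * (fderiv ℝ φ x e * vd x) ∂μ := by
    rw [← integral_sub i1 i3]
    congr 1 with x; ring
  rw [l1, l2]
  linarith

/-- A smooth function is weakly differentiable. -/
theorem isWeakDirDeriv_of_contDiff [μ.IsAddHaarMeasure] (hu : ContDiff ℝ ∞ u)
    (d : E) : IsWeakDirDeriv μ Ω d u fun x => fderiv ℝ u x d := by
  intro φ hφ hφc hφΩ
  have ext : ∀ ψ z : E → ℝ, tsupport ψ ⊆ Ω → ∫ x in Ω, ψ x * z x ∂μ = ∫ x, ψ x * z x ∂μ := by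
    intro ψ z hψ
    refine setIntegral_eq_integral_of_forall_compl_eq_zero fun x hx => ?_
    rw [image_eq_zero_of_notMem_tsupport fun h => hx (hψ h), zero_mul]
  rw [ext _ _ ((tsupport_fderiv_dir d).trans hφΩ), ext _ _ hφΩ]
  have hd := contDiff_fderiv_dir hφ d
  have hdc := hasCompactSupport_fderiv_dir hφc d
  have hint : ∀ ψ z : E → ℝ, Continuous ψ → Continuous z → HasCompactSupport ψ →
      Integrable (fun x => ψ x * z x) μ := fun ψ z h1 h2 h3 =>
    (h1.mul h2).integrable_of_hasCompactSupport h3.mul_right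
  rw [integral_mul_fderiv_eq_neg_fderiv_mul_of_integrable
    (hint _ _ hd.continuous hu.continuous hdc)
    (hint _ _ hφ.continuous (contDiff_fderiv_dir hu d).continuous hφc)
    (hint _ _ hφ.continuous hu.continuous hφc)
    (fun x _ => hφ.differentiable (by simp) x) (fun x _ => hu.differentiable (by simp) x), neg_neg]

/-- Locally integrable functions with the same integrals against test functions agree. -/
theorem ae_eq_of_integral_test_eq (hΩ : IsOpen Ω) (hu : IntegrableOn u Ω μ)
    (hv : IntegrableOn v Ω μ)
    (h : ∀ φ : E → ℝ, ContDiff ℝ ∞ φ → HasCompactSupport φ → tsupport φ ⊆ Ω →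
      ∫ x in Ω, φ x * u x ∂μ = ∫ x in Ω, φ x * v x ∂μ) : u =ᵐ[μ.restrict Ω] v := by
  have key := hΩ.ae_eq_zero_of_integral_contDiff_smul_eq_zero (μ := μ) (f := fun x => u x - v x)
    (hu.sub hv).locallyIntegrableOn ?_
  · filter_upwards [(ae_restrict_iff' hΩ.measurableSet).2 key] with x hx
    linarith
  · intro φ hφ hφc hφΩ
    have hb : ∀ z : E → ℝ, IntegrableOn z Ω μ → IntegrableOn (fun x => φ x * z x) Ω μ := by
      intro z hz
      obtain ⟨C, hC⟩ := hφc.exists_bound_of_continuous hφ.continuous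
      exact Integrable.bdd_mul hz hφ.continuous.aestronglyMeasurable (Eventually.of_forall hC)
    rw [← setIntegral_eq_integral_of_forall_compl_eq_zero (s := Ω)]
    · simp_rw [smul_eq_mul, mul_sub]
      rw [integral_sub (hb u hu) (hb v hv), h φ hφ hφc hφΩ, sub_self]
    · intro x hx
      rw [image_eq_zero_of_notMem_tsupport fun h => hx (hφΩ h), zero_smul]

theorem IsWeakDirDeriv.ae_eq {u'' : E → ℝ} (hΩ : IsOpen Ω) (h1 : IsWeakDirDeriv μ Ω d u u')
    (h2 : IsWeakDirDeriv μ Ω d v u'') (huv : u =ᵐ[μ.restrict Ω] v)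
    (hu' : IntegrableOn u' Ω μ) (hu'' : IntegrableOn u'' Ω μ) : u' =ᵐ[μ.restrict Ω] u'' := by
  refine ae_eq_of_integral_test_eq hΩ hu' hu'' fun φ hφ hφc hφΩ => ?_
  have e1 := h1 φ hφ hφc hφΩ
  have e2 := h2 φ hφ hφc hφΩ
  have e3 : ∫ x in Ω, fderiv ℝ φ x d * u x ∂μ = ∫ x in Ω, fderiv ℝ φ x d * v x ∂μ := by
    refine integral_congr_ae ?_
    filter_upwards [huv] with x hx
    rw [hx]
  linarith

/-- Weak second derivatives commute. -/
theorem IsWeakDirDeriv.ae_eq_swap {ud ue ude ued : E → ℝ} (hΩ : IsOpen Ω)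
    (hd : IsWeakDirDeriv μ Ω d u ud) (he : IsWeakDirDeriv μ Ω e u ue)
    (hde : IsWeakDirDeriv μ Ω e ud ude) (hed : IsWeakDirDeriv μ Ω d ue ued)
    (i1 : IntegrableOn ude Ω μ) (i2 : IntegrableOn ued Ω μ) : ude =ᵐ[μ.restrict Ω] ued := by
  refine ae_eq_of_integral_test_eq hΩ i1 i2 fun φ hφ hφc hφΩ => ?_
  have a1 := hde φ hφ hφc hφΩ
  have a2 := hed φ hφ hφc hφΩ
  have b1 := hd _ (contDiff_fderiv_dir hφ e) (hasCompactSupport_fderiv_dir hφc e)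
    ((tsupport_fderiv_dir e).trans hφΩ)
  have b2 := he _ (contDiff_fderiv_dir hφ d) (hasCompactSupport_fderiv_dir hφc d)
    ((tsupport_fderiv_dir d).trans hφΩ)
  simp_rw [fderiv_fderiv_comm hφ _ e d] at b1
  linarith

theorem IsWeakDirDeriv.add
    (h1 : IsWeakDirDeriv μ Ω d u u') (h2 : IsWeakDirDeriv μ Ω d v v')
    (hu : IntegrableOn u Ω μ) (hu' : IntegrableOn u' Ω μ)
    (hv : IntegrableOn v Ω μ) (hv' : IntegrableOn v' Ω μ) :
    IsWeakDirDeriv μ Ω d (fun x => u x + v x) (fun x => u' x + v' x) := by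
  intro φ hφ hφc hφΩ
  have hb : ∀ ψ z : E → ℝ, Continuous ψ → HasCompactSupport ψ → IntegrableOn z Ω μ →
      IntegrableOn (fun x => ψ x * z x) Ω μ := by
    intro ψ z h1 h2 hz
    obtain ⟨C, hC⟩ := h2.exists_bound_of_continuous h1
    exact Integrable.bdd_mul hz h1.aestronglyMeasurable (Eventually.of_forall hC)
  have hd := contDiff_fderiv_dir hφ d
  have hdc := hasCompactSupport_fderiv_dir hφc d
  simp_rw [mul_add]
  rw [integral_add (hb _ _ hd.continuous hdc hu) (hb _ _ hd.continuous hdc hv),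
    integral_add (hb _ _ hφ.continuous hφc hu') (hb _ _ hφ.continuous hφc hv'),
    h1 φ hφ hφc hφΩ, h2 φ hφ hφc hφΩ, neg_add]

theorem IsWeakDirDeriv.const_mul (c : ℝ) (h : IsWeakDirDeriv μ Ω d u u') :
    IsWeakDirDeriv μ Ω d (fun x => c * u x) (fun x => c * u' x) := by
  intro φ hφ hφc hφΩ
  simp_rw [mul_left_comm _ c]
  rw [integral_const_mul, integral_const_mul, h φ hφ hφc hφΩ, mul_neg]

/-- Lets `w⁻¹ ∂₂` be treated as the derivative along the vector `scaledDir w 1`. -/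
theorem IsWeakDirDeriv.const_smul_dir (c : ℝ) (h : IsWeakDirDeriv μ Ω d u u') :
    IsWeakDirDeriv μ Ω (c • d) u (fun x => c * u' x) := by
  intro φ hφ hφc hφΩ
  simp_rw [map_smul, smul_eq_mul, mul_assoc, mul_left_comm _ c]
  rw [integral_const_mul, integral_const_mul, h φ hφ hφc hφΩ, mul_neg]

theorem IsWeakDirDeriv.sum {ι : Type*} (s : Finset ι) {u u' : ι → E → ℝ}
    (h : ∀ k ∈ s, IsWeakDirDeriv μ Ω d (u k) (u' k))
    (hu : ∀ k ∈ s, IntegrableOn (u k) Ω μ) (hu' : ∀ k ∈ s, IntegrableOn (u' k) Ω μ) :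
    IsWeakDirDeriv μ Ω d (fun x => ∑ k ∈ s, u k x) (fun x => ∑ k ∈ s, u' k x) := by
  intro φ hφ hφc hφΩ
  have hb : ∀ ψ z : E → ℝ, Continuous ψ → HasCompactSupport ψ → IntegrableOn z Ω μ →
      IntegrableOn (fun x => ψ x * z x) Ω μ := by
    intro ψ z h1 h2 hz
    obtain ⟨C, hC⟩ := h2.exists_bound_of_continuous h1
    exact Integrable.bdd_mul hz h1.aestronglyMeasurable (Eventually.of_forall hC)
  have hd := contDiff_fderiv_dir hφ d
  have hdc := hasCompactSupport_fderiv_dir hφc d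
  simp_rw [Finset.mul_sum]
  rw [integral_finsetSum _ fun k hk => hb _ _ hd.continuous hdc (hu k hk),
    integral_finsetSum _ fun k hk => hb _ _ hφ.continuous hφc (hu' k hk),
    ← Finset.sum_neg_distrib]
  exact Finset.sum_congr rfl fun k hk => h k hk φ hφ hφc hφΩ

theorem E3.inner_eq_sum (x y : E3) : inner ℝ x y = ∑ k, x k * y k := by
  simp [PiLp.inner_apply, mul_comm]

/-- The divergence structure of `∂_d u · ∂_e v - ∂_e u · ∂_d v` for Sobolev maps into space. -/
theorem IsWeakDirDeriv.integral_mul_jacobian_inner [μ.IsAddHaarMeasure]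
    [IsFiniteMeasure (μ.restrict Ω)] {u v ud ue vd ve : E → E3} (hΩ : IsOpen Ω)
    (hud : ∀ k, IsWeakDirDeriv μ Ω d (fun x => u x k) fun x => ud x k)
    (hue : ∀ k, IsWeakDirDeriv μ Ω e (fun x => u x k) fun x => ue x k)
    (hvd : ∀ k, IsWeakDirDeriv μ Ω d (fun x => v x k) fun x => vd x k)
    (hve : ∀ k, IsWeakDirDeriv μ Ω e (fun x => v x k) fun x => ve x k)
    (lu : ∀ k, MemLp (fun x => u x k) 2 (μ.restrict Ω))
    (lud : ∀ k, MemLp (fun x => ud x k) 2 (μ.restrict Ω))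
    (lue : ∀ k, MemLp (fun x => ue x k) 2 (μ.restrict Ω))
    (lvd : ∀ k, MemLp (fun x => vd x k) 2 (μ.restrict Ω))
    (lve : ∀ k, MemLp (fun x => ve x k) 2 (μ.restrict Ω)) {φ : E → ℝ} (hφ : ContDiff ℝ ∞ φ)
    (hφc : HasCompactSupport φ) (hφΩ : tsupport φ ⊆ Ω) :
    ∫ x in Ω, φ x * (inner ℝ (ud x) (ve x) - inner ℝ (ue x) (vd x)) ∂μ
      = -∫ x in Ω, (fderiv ℝ φ x d * inner ℝ (u x) (ve x)
          - fderiv ℝ φ x e * inner ℝ (u x) (vd x)) ∂μ := by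
  have hb : ∀ (ψ : E → ℝ) (y z : E → ℝ), Continuous ψ → HasCompactSupport ψ →
      MemLp y 2 (μ.restrict Ω) → MemLp z 2 (μ.restrict Ω) →
      Integrable (fun x => ψ x * (y x * z x)) (μ.restrict Ω) := by
    intro ψ y z h1 h2 hy hz
    obtain ⟨C, hC⟩ := h2.exists_bound_of_continuous h1
    exact Integrable.bdd_mul (hy.integrable_mul hz) h1.aestronglyMeasurable
      (Eventually.of_forall hC)
  have hd := (contDiff_fderiv_dir hφ d).continuous
  have hdc := hasCompactSupport_fderiv_dir hφc d
  have he := (contDiff_fderiv_dir hφ e).continuous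
  have hec := hasCompactSupport_fderiv_dir hφc e
  have l1 : ∀ x, φ x * (inner ℝ (ud x) (ve x) - inner ℝ (ue x) (vd x))
      = ∑ k, φ x * (ud x k * ve x k - ue x k * vd x k) := by
    intro x
    simp only [E3.inner_eq_sum, ← Finset.sum_sub_distrib, Finset.mul_sum]
  have l2 : ∀ x, fderiv ℝ φ x d * inner ℝ (u x) (ve x) - fderiv ℝ φ x e * inner ℝ (u x) (vd x)
      = ∑ k, (fderiv ℝ φ x d * (u x k * ve x k) - fderiv ℝ φ x e * (u x k * vd x k)) := by
    intro x
    simp only [E3.inner_eq_sum, Finset.sum_sub_distrib, Finset.mul_sum]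
  simp_rw [l1, l2]
  rw [integral_finsetSum, integral_finsetSum, ← Finset.sum_neg_distrib]
  · exact Finset.sum_congr rfl fun k _ => IsWeakDirDeriv.integral_mul_jacobian hΩ (hud k) (hue k)
      (hvd k) (hve k) (lu k) (lud k) (lue k) (lvd k) (lve k) hφ hφc hφΩ
  · exact fun k _ => (hb _ _ _ hd hdc (lu k) (lve k)).sub (hb _ _ _ he hec (lu k) (lvd k))
  · intro k _
    simp_rw [mul_sub]
    exact (hb _ _ _ hφ.continuous hφc (lud k) (lve k)).sub
      (hb _ _ _ hφ.continuous hφc (lue k) (lvd k))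

end Lemmas

end Sobolev

/-! ### Pointwise algebra of the moving frame: Gauss and Codazzi -/

section Frame

theorem E3.inner_eq (x y : E3) : inner ℝ x y = x 0 * y 0 + x 1 * y 1 + x 2 * y 2 := by
  rw [E3.inner_eq_sum, Fin.sum_univ_three]

theorem cross_zero (a b : E3) : cross a b 0 = a 1 * b 2 - a 2 * b 1 := by
  simp [cross, crossProduct]

theorem cross_one (a b : E3) : cross a b 1 = a 2 * b 0 - a 0 * b 2 := by
  simp [cross, crossProduct]

theorem cross_two (a b : E3) : cross a b 2 = a 0 * b 1 - a 1 * b 0 := by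
  simp [cross, crossProduct]

/-- The Binet–Cauchy identity; it reduces products of normals to entries of the metric and its
derivatives. -/
theorem inner_cross_cross (a b c d : E3) : inner ℝ (cross a b) (cross c d)
    = inner ℝ a c * inner ℝ b d - inner ℝ a d * inner ℝ b c := by
  simp only [E3.inner_eq, cross_zero, cross_one, cross_two]
  ring

theorem inner_cross_left (a b : E3) : inner ℝ a (cross a b) = 0 := by
  simp only [E3.inner_eq, cross_zero, cross_one, cross_two]
  ring

theorem inner_cross_right (a b : E3) : inner ℝ b (cross a b) = 0 := by
  simp only [E3.inner_eq, cross_zero, cross_one, cross_two]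
  ring

theorem inner_cross_swap_left (a b c : E3) : inner ℝ a (cross c b) = - inner ℝ c (cross a b) := by
  simp only [E3.inner_eq, cross_zero, cross_one, cross_two]
  ring

theorem inner_cross_swap_right (a b c : E3) : inner ℝ b (cross a c) = - inner ℝ c (cross a b) := by
  simp only [E3.inner_eq, cross_zero, cross_one, cross_two]
  ring

/-- Parseval's identity for the orthogonal frame `p, q, p × q`. -/
theorem inner_eq_frame {p q : E3} {g : ℝ} (hg : g ≠ 0) (hpp : inner ℝ p p = g ^ 2)
    (hqq : inner ℝ q q = 1) (hpq : inner ℝ p q = 0) (x y : E3) :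
    g ^ 2 * inner ℝ x y = inner ℝ x p * inner ℝ y p + g ^ 2 * (inner ℝ x q * inner ℝ y q)
      + inner ℝ x (cross p q) * inner ℝ y (cross p q) := by
  have hN : inner ℝ (cross p q) (cross p q) = g ^ 2 := by
    rw [inner_cross_cross, hpp, hqq, hpq]; ring
  have hpN := inner_cross_left p q
  have hqN := inner_cross_right p q
  set N := cross p q
  simp only [E3.inner_eq] at hpp hqq hpq hN hpN hqN
  -- The matrix with rows `p / g`, `q`, `N / g` is orthogonal. A one-sided inverse of a square
  -- matrix is two-sided, and the reversed product is the resolution of the identity that Parseval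
  -- needs.
  have key : (!![p 0 / g, p 1 / g, p 2 / g; q 0, q 1, q 2; N 0 / g, N 1 / g, N 2 / g] :
      Matrix (Fin 3) (Fin 3) ℝ)
      * !![p 0 / g, q 0, N 0 / g; p 1 / g, q 1, N 1 / g; p 2 / g, q 2, N 2 / g] = 1 := by
    ext i j
    fin_cases i <;> fin_cases j <;>
      simp [Matrix.mul_apply, Fin.sum_univ_three] <;> field_simp <;> linarith
  have key2 := mul_eq_one_comm.1 key
  have e : ∀ i j, g ^ 2 * (!![p 0 / g, q 0, N 0 / g; p 1 / g, q 1, N 1 / g; p 2 / g, q 2, N 2 / g] *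
    (!![p 0 / g, p 1 / g, p 2 / g; q 0, q 1, q 2; N 0 / g, N 1 / g, N 2 / g] :
      Matrix (Fin 3) (Fin 3) ℝ)) i j = g ^ 2 * (1 : Matrix (Fin 3) (Fin 3) ℝ) i j :=
    fun i j => by rw [key2]
  have hx : ∀ a b : ℝ, g ^ 2 * (a / g * (b / g)) = a * b := fun a b => by field_simp
  have e00 := e 0 0
  have e01 := e 0 1
  have e02 := e 0 2
  have e11 := e 1 1
  have e12 := e 1 2
  have e22 := e 2 2
  simp [Matrix.mul_apply, Fin.sum_univ_three, mul_add, hx] at e00 e01 e02 e11 e12 e22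
  simp only [E3.inner_eq]
  linear_combination -(x 0 * y 0) * e00 - (x 0 * y 1 + x 1 * y 0) * e01
    - (x 0 * y 2 + x 2 * y 0) * e02 - (x 1 * y 1) * e11 - (x 1 * y 2 + x 2 * y 1) * e12
    - (x 2 * y 2) * e22

/-- The pointwise relations between the first and second (rescaled) derivatives `p, q` and
`p₁, p₂ = q₁, q₂` of an isometric immersion of the metric `g² dz₁² + dz₂²`, `∂₂ g = -κ`. -/
structure FrameRel (κ g : ℝ) (p q p₁ p₂ q₂ : E3) : Prop where
  pp : inner ℝ p p = g ^ 2
  qq : inner ℝ q q = 1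
  pq : inner ℝ p q = 0
  p₁p : inner ℝ p₁ p = 0
  p₁q : inner ℝ p₁ q = κ * g
  p₂p : inner ℝ p₂ p = -κ * g
  p₂q : inner ℝ p₂ q = 0
  q₂p : inner ℝ q₂ p = 0
  q₂q : inner ℝ q₂ q = 0

namespace FrameRel

variable {κ g : ℝ} {p q p₁ p₂ q₂ : E3} (h : FrameRel κ g p q p₁ p₂ q₂)

include h

theorem norm_cross (hg : 0 < g) : ‖cross p q‖ = g := by
  have : ‖cross p q‖ ^ 2 = g ^ 2 := by
    rw [← real_inner_self_eq_norm_sq, inner_cross_cross, h.pp, h.qq, h.pq]; ring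
  exact (pow_left_inj₀ (norm_nonneg _) hg.le two_ne_zero).1 this

theorem inner_cross (hg : 0 < g) (x : E3) :
    inner ℝ x (cross p q) = g * inner ℝ x (unitNormal p q) := by
  rw [unitNormal, inner_smul_right, h.norm_cross hg]
  field_simp

/-- Expand both products in the frame. The tangential part of the first is zero, that of the second
is `κ²`, coming from `p₂ · p = -κ g`. -/
theorem gauss (hg : 0 < g) : inner ℝ p₁ q₂ - inner ℝ p₂ p₂
    = inner ℝ p₁ (unitNormal p q) * inner ℝ q₂ (unitNormal p q)
      - inner ℝ p₂ (unitNormal p q) ^ 2 - κ ^ 2 := by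
  have e1 := inner_eq_frame hg.ne' h.pp h.qq h.pq p₁ q₂
  have e2 := inner_eq_frame hg.ne' h.pp h.qq h.pq p₂ p₂
  rw [h.inner_cross hg, h.inner_cross hg] at e1
  rw [h.inner_cross hg] at e2
  rw [h.p₁p, h.q₂p, h.p₁q, h.q₂q] at e1
  rw [h.p₂p, h.p₂q] at e2
  have : g ^ 2 ≠ 0 := by positivity
  apply mul_left_cancel₀ this
  linear_combination e1 - e2

/-- The vectors `N₁`, `N₂` of the proof are the Leibniz derivatives of `N = p × q`, so the left side
is `∂₁N · ∂₂p - ∂₂N · ∂₁p`, the Jacobian of the pair `(N, p)`. Working with `N`, of length `g`,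
instead of the unit normal keeps everything bilinear. -/
theorem codazzi (hg : 0 < g) :
    inner ℝ (cross p₁ q + cross p p₂) p₂ - inner ℝ (cross p₂ q + cross p q₂) p₁
    = 2 * κ * inner ℝ p₁ (unitNormal p q) + κ * g ^ 2 * inner ℝ q₂ (unitNormal p q) := by
  set N₁ := cross p₁ q + cross p p₂ with hN₁
  set N₂ := cross p₂ q + cross p q₂ with hN₂
  have e1 := inner_eq_frame hg.ne' h.pp h.qq h.pq N₁ p₂
  have e2 := inner_eq_frame hg.ne' h.pp h.qq h.pq N₂ p₁
  have a1 : inner ℝ N₁ p = -(g * inner ℝ p₁ (unitNormal p q)) := by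
    rw [real_inner_comm, hN₁, inner_add_right, inner_cross_left, inner_cross_swap_left,
      h.inner_cross hg, add_zero]
  have a2 : inner ℝ N₂ q = -(g * inner ℝ q₂ (unitNormal p q)) := by
    rw [real_inner_comm, hN₂, inner_add_right, inner_cross_right, inner_cross_swap_right,
      h.inner_cross hg, zero_add]
  have a3 : inner ℝ N₁ (cross p q) = 0 := by
    rw [hN₁, inner_add_left, inner_cross_cross, inner_cross_cross,
      h.p₁p, h.p₁q, h.p₂q, h.pq, h.qq, h.pp, real_inner_comm p q, h.pq]
    ring
  have a4 : inner ℝ N₂ (cross p q) = -κ * g := by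
    rw [hN₂, inner_add_left, inner_cross_cross, inner_cross_cross,
      h.p₂p, h.p₂q, h.pq, h.qq, h.pp, h.q₂p, h.q₂q, real_inner_comm p q, h.pq]
    ring
  rw [a1, a3, h.p₂p, h.p₂q] at e1
  rw [a2, a4, h.p₁p, h.p₁q, h.inner_cross hg] at e2
  have : g ^ 2 ≠ 0 := by positivity
  apply mul_left_cancel₀ this
  linear_combination e1 - e2

end FrameRel

end Frame

/-! ### Weak Gauss and Codazzi equations for rescaled isometries -/

section Isometry

theorem isOpen_strip (L : ℝ) : IsOpen (strip L) := isOpen_Ioo.prod isOpen_Ioo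

theorem volume_strip {L : ℝ} : volume (strip L) = ENNReal.ofReal L := by
  rw [strip, Measure.volume_eq_prod, Measure.prod_prod]
  norm_num

instance isFiniteMeasure_strip (L : ℝ) :
    IsFiniteMeasure ((volume : Measure (ℝ × ℝ)).restrict (strip L)) :=
  ⟨by simp [volume_strip]⟩

theorem integrableOn_strip_of_continuous {L : ℝ} {u : ℝ × ℝ → ℝ} (hu : Continuous u) :
    IntegrableOn u (strip L) :=
  (hu.continuousOn.integrableOn_compact (isCompact_Icc.prod isCompact_Icc)).mono_set
    (prod_mono Ioo_subset_Icc_self Ioo_subset_Icc_self)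

/-- The rescaled coordinate directions. -/
noncomputable def scaledDir (w : ℝ) (j : Fin 2) : ℝ × ℝ := scale w j • dir j

theorem IsWeakPartial.coord {Ω : Set (ℝ × ℝ)} {i : Fin 2} {F G : ℝ × ℝ → E3}
    [IsFiniteMeasure ((volume : Measure (ℝ × ℝ)).restrict Ω)]
    (h : IsWeakPartial Ω i F G) (hF : MemLp F 2 (volume.restrict Ω))
    (hG : MemLp G 2 (volume.restrict Ω)) (k : Fin 3) :
    IsWeakDirDeriv volume Ω (dir i) (fun x => F x k) (fun x => G x k) := by
  intro φ hφ hφc hφΩ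
  have hb : ∀ (ψ : ℝ × ℝ → ℝ) (H : ℝ × ℝ → E3), Continuous ψ → HasCompactSupport ψ →
      MemLp H 2 (volume.restrict Ω) → Integrable (fun x => ψ x • H x) (volume.restrict Ω) := by
    intro ψ H h1 h2 hH
    obtain ⟨C, hC⟩ := h2.exists_bound_of_continuous h1
    exact (hH.integrable one_le_two).bdd_smul C h1.aestronglyMeasurable (Eventually.of_forall hC)
  have hd := contDiff_fderiv_dir hφ (dir i)
  have hdc := hasCompactSupport_fderiv_dir hφc (dir i)
  have key := congrArg (EuclideanSpace.proj k : E3 →L[ℝ] ℝ) (h φ hφ hφc hφΩ)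
  rw [map_neg, ← ContinuousLinearMap.integral_comp_comm _ (hb _ _ hd.continuous hdc hF),
    ← ContinuousLinearMap.integral_comp_comm _ (hb _ _ hφ.continuous hφc hG)] at key
  simpa using key

theorem memLp_coord {Ω : Set (ℝ × ℝ)} {F : ℝ × ℝ → E3} (hF : MemLp F 2 (volume.restrict Ω))
    (c : ℝ) (k : Fin 3) : MemLp (fun x => (c • F x) k) 2 (volume.restrict Ω) :=
  (EuclideanSpace.proj k : E3 →L[ℝ] ℝ).comp_memLp' (hF.const_smul c)

namespace W22

variable {L : ℝ} (f : W22 L) (w : ℝ)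

theorem memLp_rgrad (i : Fin 2) (k : Fin 3) :
    MemLp (fun x => f.rgrad w i x k) 2 (volume.restrict (strip L)) :=
  memLp_coord (f.memLp_grad i) _ k

theorem memLp_rhess (i j : Fin 2) (k : Fin 3) :
    MemLp (fun x => f.rhess w i j x k) 2 (volume.restrict (strip L)) :=
  memLp_coord (f.memLp_hess i j) _ k

theorem isWeakDirDeriv_rgrad (i j : Fin 2) (k : Fin 3) :
    IsWeakDirDeriv volume (strip L) (scaledDir w j) (fun x => f.rgrad w i x k)
      (fun x => f.rhess w i j x k) := by
  have h := (((f.weak_hess i j).coord (f.memLp_grad i) (f.memLp_hess i j) k).const_mul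
    (scale w i)).const_smul_dir (scale w j)
  have e : (fun x => f.rhess w i j x k)
      = fun x => scale w j * (scale w i * f.hess i j x k) := by
    ext x
    simp only [rhess, PiLp.smul_apply, smul_eq_mul]
    ring
  rw [e]
  exact h

theorem rhess_symm : ∀ᵐ x ∂(volume.restrict (strip L)), f.rhess w 1 0 x = f.rhess w 0 1 x := by
  have h : ∀ k, (fun x => f.hess 0 1 x k) =ᵐ[volume.restrict (strip L)]
      fun x => f.hess 1 0 x k := fun k =>
    IsWeakDirDeriv.ae_eq_swap (isOpen_strip L)
      ((f.weak_grad 0).coord f.memLp_toFun (f.memLp_grad 0) k)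
      ((f.weak_grad 1).coord f.memLp_toFun (f.memLp_grad 1) k)
      ((f.weak_hess 0 1).coord (f.memLp_grad 0) (f.memLp_hess 0 1) k)
      ((f.weak_hess 1 0).coord (f.memLp_grad 1) (f.memLp_hess 1 0) k)
      (((EuclideanSpace.proj k : E3 →L[ℝ] ℝ).comp_memLp' (f.memLp_hess 0 1)).integrable one_le_two)
      (((EuclideanSpace.proj k : E3 →L[ℝ] ℝ).comp_memLp' (f.memLp_hess 1 0)).integrable one_le_two)
  filter_upwards [h 0, h 1, h 2] with x h0 h1 h2
  ext k
  fin_cases k <;> simp_all [rhess, mul_comm]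

variable {f w} {κ : ℝ}

/-- The diagonal of the metric is the squared length of the columns of `∇_w f`. Boundedness of the
gradient is what puts `∂₁f × ∂₂f` and its weak derivatives in `L²`. -/
theorem abs_rgrad_le (hf : IsRescaledIsometry κ w f) (i : Fin 2) (k : Fin 3) :
    ∀ᵐ x ∂(volume.restrict (strip L)), ‖f.rgrad w i x k‖ ≤ 1 + |κ * w| := by
  filter_upwards [hf, ae_restrict_mem (isOpen_strip L).measurableSet] with x hx hxs
  have h1 := hx i i
  have h2 : (f.rgrad w i x k) ^ 2 ≤ inner ℝ (f.rgrad w i x) (f.rgrad w i x) := by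
    rw [E3.inner_eq_sum]
    simpa [sq] using Finset.single_le_sum (f := fun k => f.rgrad w i x k * f.rgrad w i x k)
      (fun k _ => mul_self_nonneg _) (Finset.mem_univ k)
  have h3 : refMetric κ (x.1, w * x.2) i i ≤ (1 + |κ * w|) ^ 2 := by
    have hxa : |x.2| ≤ 1 := by
      have := hxs.2
      rw [abs_le]
      constructor <;> linarith [this.1, this.2]
    have h4 : |κ * (w * x.2)| ≤ |κ * w| := by
      rw [← mul_assoc, abs_mul]
      exact mul_le_of_le_one_right (abs_nonneg _) hxa
    have := abs_le.1 h4
    have h5 := abs_nonneg (κ * w)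
    fin_cases i
    · exact sq_le_sq' (by linarith) (by linarith)
    · exact one_le_pow₀ (by linarith)
  rw [Real.norm_eq_abs]
  exact abs_le_of_sq_le_sq (by linarith) (by positivity)

theorem memLp_top_rgrad (hf : IsRescaledIsometry κ w f) (i : Fin 2) (k : Fin 3) :
    MemLp (fun x => f.rgrad w i x k) ⊤ (volume.restrict (strip L)) :=
  memLp_top_of_bound (f.memLp_rgrad w i k).aestronglyMeasurable _ (abs_rgrad_le hf i k)

/-- The two sides of the metric identity have the same weak derivative: one is computed by the
product rule, the other classically. -/
theorem metric_deriv (hf : IsRescaledIsometry κ w f) (i j l : Fin 2)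
    (hsm : ContDiff ℝ ∞ fun x : ℝ × ℝ => refMetric κ (x.1, w * x.2) i j)
    (hsi : Integrable (fun x : ℝ × ℝ => fderiv ℝ
      (fun x : ℝ × ℝ => refMetric κ (x.1, w * x.2) i j) x (scaledDir w l))
      (volume.restrict (strip L))) :
    ∀ᵐ x ∂(volume.restrict (strip L)),
      inner ℝ (f.rhess w i l x) (f.rgrad w j x) + inner ℝ (f.rgrad w i x) (f.rhess w j l x)
        = fderiv ℝ (fun x : ℝ × ℝ => refMetric κ (x.1, w * x.2) i j) x (scaledDir w l) := by
  have i1 : ∀ k, Integrable (fun x => f.rgrad w i x k * f.rgrad w j x k)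
      (volume.restrict (strip L)) := fun k =>
    (f.memLp_rgrad w i k).integrable_mul (f.memLp_rgrad w j k)
  have i2 : ∀ k, Integrable (fun x => f.rhess w i l x k * f.rgrad w j x k
      + f.rgrad w i x k * f.rhess w j l x k) (volume.restrict (strip L)) := fun k =>
    ((f.memLp_rhess w i l k).integrable_mul (f.memLp_rgrad w j k)).add
      ((f.memLp_rgrad w i k).integrable_mul (f.memLp_rhess w j l k))
  have h1 := IsWeakDirDeriv.sum (Finset.univ : Finset (Fin 3))
    (fun k _ => (f.isWeakDirDeriv_rgrad w i l k).mul (isOpen_strip L)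
      (f.isWeakDirDeriv_rgrad w j l k) (f.memLp_rgrad w i k) (f.memLp_rhess w i l k)
      (f.memLp_rgrad w j k) (f.memLp_rhess w j l k)) (fun k _ => i1 k) (fun k _ => i2 k)
  have h2 := isWeakDirDeriv_of_contDiff (μ := volume) (Ω := strip L) hsm (scaledDir w l)
  have := h1.ae_eq (isOpen_strip L) h2 (by
    filter_upwards [hf] with x hx
    rw [← hx i j, E3.inner_eq_sum]) (integrable_finsetSum _ fun k _ => i2 k) hsi
  filter_upwards [this] with x hx
  rw [← hx, E3.inner_eq_sum, E3.inner_eq_sum, Finset.sum_add_distrib]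

theorem hasFDerivAt_scaled_snd (x : ℝ × ℝ) :
    HasFDerivAt (fun x : ℝ × ℝ => 1 - κ * (w * x.2))
      (-(κ • w • ContinuousLinearMap.snd ℝ ℝ ℝ)) x :=
  ((hasFDerivAt_snd.const_mul w).const_mul κ).const_sub 1

theorem contDiff_scaled_snd : ContDiff ℝ ∞ fun x : ℝ × ℝ => 1 - κ * (w * x.2) := by fun_prop

theorem one_sub_pos (hwκ : |κ * w| < 1) {x : ℝ × ℝ} (hx : x ∈ strip L) :
    0 < 1 - κ * (w * x.2) := by
  have hxa : |x.2| ≤ 1 := by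
    have := hx.2
    rw [abs_le]
    constructor <;> linarith [this.1, this.2]
  have h4 : |κ * (w * x.2)| ≤ |κ * w| := by
    rw [← mul_assoc, abs_mul]
    exact mul_le_of_le_one_right (abs_nonneg _) hxa
  linarith [le_abs_self (κ * (w * x.2))]

/-- The first-order relations satisfied by the derivatives of a rescaled isometry. -/
theorem frameRel (hw : 0 < w) (hf : IsRescaledIsometry κ w f) :
    ∀ᵐ x ∂(volume.restrict (strip L)), FrameRel κ (1 - κ * (w * x.2)) (f.rgrad w 0 x)
      (f.rgrad w 1 x) (f.rhess w 0 0 x) (f.rhess w 0 1 x) (f.rhess w 1 1 x) := by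
  have e00 : ∀ (x d : ℝ × ℝ), fderiv ℝ (fun x : ℝ × ℝ => refMetric κ (x.1, w * x.2) 0 0) x d
      = 2 * (1 - κ * (w * x.2)) * (-(κ * (w * d.2))) := by
    intro x d
    have : HasFDerivAt (fun x : ℝ × ℝ => refMetric κ (x.1, w * x.2) 0 0) _ x :=
      (hasFDerivAt_scaled_snd (κ := κ) (w := w) x).pow 2
    rw [this.fderiv]
    simp
  have e01 : ∀ (x d : ℝ × ℝ),
      fderiv ℝ (fun x : ℝ × ℝ => refMetric κ (x.1, w * x.2) 0 1) x d = 0 := by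
    simp [refMetric]
  have e11 : ∀ (x d : ℝ × ℝ),
      fderiv ℝ (fun x : ℝ × ℝ => refMetric κ (x.1, w * x.2) 1 1) x d = 0 := by
    simp [refMetric]
  have c00 : ContDiff ℝ ∞ (fun x : ℝ × ℝ => refMetric κ (x.1, w * x.2) 0 0) :=
    contDiff_scaled_snd.pow 2
  have c01 : ContDiff ℝ ∞ (fun x : ℝ × ℝ => refMetric κ (x.1, w * x.2) 0 1) := contDiff_const
  have c11 : ContDiff ℝ ∞ (fun x : ℝ × ℝ => refMetric κ (x.1, w * x.2) 1 1) := contDiff_const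
  have h000 := metric_deriv hf 0 0 0 c00 (by simp [e00, scaledDir, dir])
  have h001 := metric_deriv hf 0 0 1 c00 (by
    simp_rw [e00]
    exact integrableOn_strip_of_continuous (by fun_prop))
  have h010 := metric_deriv hf 0 1 0 c01 (by simp [e01])
  have h011 := metric_deriv hf 0 1 1 c01 (by simp [e01])
  have h110 := metric_deriv hf 1 1 0 c11 (by simp [e11])
  have h111 := metric_deriv hf 1 1 1 c11 (by simp [e11])
  filter_upwards [hf, f.rhess_symm w, h000, h001, h010, h011, h110, h111] with x hx hs
    h000 h001 h010 h011 h110 h111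
  rw [e00] at h000 h001
  rw [e01] at h010 h011
  rw [e11] at h110 h111
  rw [hs] at h010 h110
  have d0 : (scaledDir w 0).2 = 0 := by simp [scaledDir, dir]
  -- The factor `w⁻¹` of the rescaled derivative cancels the `w` in the argument of the metric.
  have d1 : w * (scaledDir w 1).2 = 1 := by simp [scaledDir, dir, scale, hw.ne']
  rw [d0] at h000
  rw [d1] at h001
  have c1 := real_inner_comm (f.rgrad w 0 x) (f.rhess w 0 0 x)
  have c2 := real_inner_comm (f.rgrad w 0 x) (f.rhess w 0 1 x)
  have c3 := real_inner_comm (f.rgrad w 0 x) (f.rhess w 1 1 x)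
  have c4 := real_inner_comm (f.rgrad w 1 x) (f.rhess w 0 1 x)
  have c5 := real_inner_comm (f.rgrad w 1 x) (f.rhess w 1 1 x)
  -- The differentiated metric gives six linear equations, which determine the six tangential
  -- components of the Hessian, as for Christoffel symbols.
  refine ⟨hx 0 0, hx 1 1, hx 0 1, ?_, ?_, ?_, ?_, ?_, ?_⟩ <;> linarith

theorem secondForm_symm : ∀ᵐ x ∂(volume.restrict (strip L)),
    f.secondForm w x 1 0 = f.secondForm w x 0 1 := by
  filter_upwards [f.rhess_symm w] with x hx
  simp only [secondForm, Matrix.of_apply, hx]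

/-- Rescaled isometries of the flat reference metric have vanishing Gauss curvature. -/
theorem det_secondForm (hw : 0 < w) (hwκ : |κ * w| < 1) (hf : IsRescaledIsometry κ w f) :
    ∀ᵐ x ∂(volume.restrict (strip L)),
      f.secondForm w x 0 0 * f.secondForm w x 1 1 = f.secondForm w x 0 1 ^ 2 := by
  -- The Jacobian of the pair `(∂₁f, ∂₂f)` is a divergence of tangential products, which the metric
  -- determines; its value `-κ²` is exactly the tangential term in `FrameRel.gauss`, so the
  -- determinant is zero.
  have hJ : (fun x => inner ℝ (f.rhess w 0 0 x) (f.rhess w 1 1 x)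
      - inner ℝ (f.rhess w 0 1 x) (f.rhess w 1 0 x)) =ᵐ[volume.restrict (strip L)]
      fun _ => -κ ^ 2 := by
    have hin : ∀ i j l m : Fin 2, IntegrableOn (fun x =>
        inner ℝ (f.rhess w i j x) (f.rhess w l m x)) (strip L) := by
      intro i j l m
      simp_rw [E3.inner_eq_sum]
      exact integrable_finsetSum _ fun k _ =>
        (f.memLp_rhess w i j k).integrable_mul (f.memLp_rhess w l m k)
    refine ae_eq_of_integral_test_eq (isOpen_strip L) ((hin 0 0 1 1).sub (hin 0 1 1 0))
      (integrable_const _) fun φ hφ hφc hφΩ => ?_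
    rw [IsWeakDirDeriv.integral_mul_jacobian_inner (isOpen_strip L)
      (f.isWeakDirDeriv_rgrad w 0 0) (f.isWeakDirDeriv_rgrad w 0 1)
      (f.isWeakDirDeriv_rgrad w 1 0) (f.isWeakDirDeriv_rgrad w 1 1)
      (f.memLp_rgrad w 0) (f.memLp_rhess w 0 0) (f.memLp_rhess w 0 1) (f.memLp_rhess w 1 0)
      (f.memLp_rhess w 1 1) hφ hφc hφΩ]
    have hg := (isWeakDirDeriv_of_contDiff (μ := volume) (Ω := strip L)
      (contDiff_scaled_snd (κ := κ) (w := w)) (scaledDir w 1)).const_mul κ φ hφ hφc hφΩ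
    have e1 : ∫ x in strip L, (fderiv ℝ φ x (scaledDir w 0) *
          inner ℝ (f.rgrad w 0 x) (f.rhess w 1 1 x)
        - fderiv ℝ φ x (scaledDir w 1) * inner ℝ (f.rgrad w 0 x) (f.rhess w 1 0 x))
        = ∫ x in strip L, fderiv ℝ φ x (scaledDir w 1) * (κ * (1 - κ * (w * x.2))) := by
      refine integral_congr_ae ?_
      filter_upwards [frameRel hw hf, f.rhess_symm w] with x hx hs
      rw [hs, real_inner_comm, hx.q₂p, real_inner_comm, hx.p₂p]
      ring
    rw [e1, hg, neg_neg]
    congr 1 with x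
    simp only
    rw [(hasFDerivAt_scaled_snd (κ := κ) (w := w) x).fderiv]
    simp [scaledDir, dir, scale, hw.ne', sq]
  filter_upwards [hJ, frameRel hw hf, f.rhess_symm w, ae_restrict_mem (isOpen_strip L).measurableSet]
    with x h1 h2 h3 hx
  have h4 := h2.gauss (one_sub_pos hwκ hx)
  rw [h3] at h1
  simp only [secondForm, Matrix.of_apply, normal]
  linarith

/-- The weak Codazzi equation. -/
theorem codazzi (hw : 0 < w) (hwκ : |κ * w| < 1) (hf : IsRescaledIsometry κ w f)
    {φ : ℝ × ℝ → ℝ} (hφ : ContDiff ℝ ∞ φ) (hφc : HasCompactSupport φ)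
    (hφΩ : tsupport φ ⊆ strip L) :
    ∫ x in strip L, φ x * (2 * κ * f.secondForm w x 0 0
        + κ * (1 - κ * (w * x.2)) ^ 2 * f.secondForm w x 1 1)
      = -∫ x in strip L, (1 - κ * (w * x.2)) * (fderiv ℝ φ x (1, 0) * f.secondForm w x 0 1
          - w⁻¹ * fderiv ℝ φ x (0, 1) * f.secondForm w x 0 0) := by
  set N : ℝ × ℝ → E3 := fun x => cross (f.rgrad w 0 x) (f.rgrad w 1 x) with hN
  set N' : Fin 2 → ℝ × ℝ → E3 := fun l x => cross (f.rhess w 0 l x) (f.rgrad w 1 x)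
    + cross (f.rgrad w 0 x) (f.rhess w 1 l x) with hN'
  have l1 : ∀ k m : Fin 3, MemLp (fun x => f.rgrad w 0 x k * f.rgrad w 1 x m) 2
      (volume.restrict (strip L)) := fun k m =>
    (f.memLp_rgrad w 1 m).mul' (memLp_top_rgrad hf 0 k)
  have l2 : ∀ (l : Fin 2) (k m : Fin 3), MemLp (fun x => f.rhess w 0 l x k * f.rgrad w 1 x m
      + f.rgrad w 0 x k * f.rhess w 1 l x m) 2 (volume.restrict (strip L)) := fun l k m =>
    ((memLp_top_rgrad hf 1 m).mul' (f.memLp_rhess w 0 l k)).add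
      ((f.memLp_rhess w 1 l m).mul' (memLp_top_rgrad hf 0 k))
  have l3 : ∀ (l : Fin 2) (k m : Fin 3), IsWeakDirDeriv volume (strip L) (scaledDir w l)
      (fun x => f.rgrad w 0 x k * f.rgrad w 1 x m) (fun x => f.rhess w 0 l x k * f.rgrad w 1 x m
      + f.rgrad w 0 x k * f.rhess w 1 l x m) := fun l k m =>
    (f.isWeakDirDeriv_rgrad w 0 l k).mul (isOpen_strip L)
      (f.isWeakDirDeriv_rgrad w 1 l m) (f.memLp_rgrad w 0 k) (f.memLp_rhess w 0 l k)
      (f.memLp_rgrad w 1 m) (f.memLp_rhess w 1 l m)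
  have lN : ∀ k m : Fin 3, MemLp (fun x => f.rgrad w 0 x k * f.rgrad w 1 x m
      - f.rgrad w 0 x m * f.rgrad w 1 x k) 2 (volume.restrict (strip L)) := fun k m =>
    (l1 k m).sub (l1 m k)
  have lN' : ∀ (l : Fin 2) (k m : Fin 3), MemLp (fun x => (f.rhess w 0 l x k * f.rgrad w 1 x m
      + f.rgrad w 0 x k * f.rhess w 1 l x m) - (f.rhess w 0 l x m * f.rgrad w 1 x k
      + f.rgrad w 0 x m * f.rhess w 1 l x k)) 2 (volume.restrict (strip L)) := fun l k m =>
    (l2 l k m).sub (l2 l m k)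
  have lD : ∀ (l : Fin 2) (k m : Fin 3), IsWeakDirDeriv volume (strip L) (scaledDir w l)
      (fun x => f.rgrad w 0 x k * f.rgrad w 1 x m - f.rgrad w 0 x m * f.rgrad w 1 x k)
      (fun x => (f.rhess w 0 l x k * f.rgrad w 1 x m
      + f.rgrad w 0 x k * f.rhess w 1 l x m) - (f.rhess w 0 l x m * f.rgrad w 1 x k
      + f.rgrad w 0 x m * f.rhess w 1 l x k)) := by
    intro l k m
    have := (l3 l k m).add ((l3 l m k).const_mul (-1)) ((l1 k m).integrable one_le_two)
      ((l2 l k m).integrable one_le_two) (((l1 m k).integrable one_le_two).const_mul (-1))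
      (((l2 l m k).integrable one_le_two).const_mul (-1))
    simpa only [neg_one_mul, ← sub_eq_add_neg] using this
  -- Each component of `N` is a `2 × 2` minor of the gradient, so one statement about minors serves
  -- all three.
  have hNk : ∀ k, ∃ a b : Fin 3, (∀ x, N x k = f.rgrad w 0 x a * f.rgrad w 1 x b
      - f.rgrad w 0 x b * f.rgrad w 1 x a) ∧ ∀ l x, N' l x k
      = (f.rhess w 0 l x a * f.rgrad w 1 x b
      + f.rgrad w 0 x a * f.rhess w 1 l x b) - (f.rhess w 0 l x b * f.rgrad w 1 x a
      + f.rgrad w 0 x b * f.rhess w 1 l x a) := by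
    intro k
    fin_cases k
    · refine ⟨1, 2, fun x => cross_zero _ _, fun l x => ?_⟩
      simp only [hN', Fin.zero_eta, PiLp.add_apply, cross_zero]
      ring
    · refine ⟨2, 0, fun x => cross_one _ _, fun l x => ?_⟩
      simp only [hN', Fin.mk_one, PiLp.add_apply, cross_one]
      ring
    · refine ⟨0, 1, fun x => cross_two _ _, fun l x => ?_⟩
      simp only [hN', Fin.reduceFinMk, PiLp.add_apply, cross_two]
      ring
  have mN : ∀ k, MemLp (fun x => N x k) 2 (volume.restrict (strip L)) := by
    intro k
    obtain ⟨a, b, h, -⟩ := hNk k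
    simpa only [h] using lN a b
  have mN' : ∀ l k, MemLp (fun x => N' l x k) 2 (volume.restrict (strip L)) := by
    intro l k
    obtain ⟨a, b, -, h⟩ := hNk k
    simpa only [h] using lN' l a b
  have mD : ∀ l k, IsWeakDirDeriv volume (strip L) (scaledDir w l) (fun x => N x k)
      (fun x => N' l x k) := by
    intro l k
    obtain ⟨a, b, h, h'⟩ := hNk k
    simpa only [h, h'] using lD l a b
  -- The Jacobian identity for the pair `(N, ∂₁f)`: its left side is evaluated by
  -- `FrameRel.codazzi`, while on the right `N` paired with the Hessian is `g` times the second
  -- fundamental form.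
  have key := IsWeakDirDeriv.integral_mul_jacobian_inner (isOpen_strip L) (mD 0) (mD 1)
    (f.isWeakDirDeriv_rgrad w 0 0) (f.isWeakDirDeriv_rgrad w 0 1) mN (mN' 0) (mN' 1)
    (f.memLp_rhess w 0 0) (f.memLp_rhess w 0 1) hφ hφc hφΩ
  have hall := (frameRel hw hf).and ((f.rhess_symm w).and
    (ae_restrict_mem (μ := volume) (isOpen_strip L).measurableSet))
  have e1 : ∫ x in strip L, φ x * (inner ℝ (N' 0 x) (f.rhess w 0 1 x)
      - inner ℝ (N' 1 x) (f.rhess w 0 0 x)) = ∫ x in strip L, φ x *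
        (2 * κ * f.secondForm w x 0 0 + κ * (1 - κ * (w * x.2)) ^ 2 * f.secondForm w x 1 1) := by
    refine integral_congr_ae ?_
    filter_upwards [hall] with x ⟨h1, h2, hx⟩
    simp only [hN', h2]
    rw [h1.codazzi (one_sub_pos hwκ hx)]
    rfl
  have e2 : ∫ x in strip L, (fderiv ℝ φ x (scaledDir w 0) * inner ℝ (N x) (f.rhess w 0 1 x)
      - fderiv ℝ φ x (scaledDir w 1) * inner ℝ (N x) (f.rhess w 0 0 x))
      = ∫ x in strip L, (1 - κ * (w * x.2)) * (fderiv ℝ φ x (1, 0) * f.secondForm w x 0 1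
          - w⁻¹ * fderiv ℝ φ x (0, 1) * f.secondForm w x 0 0) := by
    refine integral_congr_ae ?_
    filter_upwards [hall] with x ⟨h1, h2, hx⟩
    simp only [hN]
    rw [real_inner_comm (f.rhess w 0 1 x), h1.inner_cross (one_sub_pos hwκ hx),
      real_inner_comm (f.rhess w 0 0 x), h1.inner_cross (one_sub_pos hwκ hx)]
    simp only [secondForm, Matrix.of_apply, normal, scaledDir, map_smul, scale, dir]
    simp
    ring
  rw [← e1, key, e2]

end W22

end Isometry

/-! ### The lower bound `∫ |II - II⁰|² ≥ c w` -/

section LowerBound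

theorem continuous_cross : Continuous fun z : E3 × E3 => cross z.1 z.2 := by
  refine (PiLp.continuous_toLp 2 _).comp (continuous_pi fun k => ?_)
  fin_cases k <;> simp [crossProduct] <;> fun_prop

theorem norm_unitNormal_le (a b : E3) : ‖unitNormal a b‖ ≤ 1 := by
  rw [unitNormal, norm_smul, norm_inv, norm_norm]
  exact inv_mul_le_one

namespace W22

variable {L : ℝ} (f : W22 L) (w : ℝ)

theorem memLp_secondForm (i j : Fin 2) :
    MemLp (fun x => f.secondForm w x i j) 2 (volume.restrict (strip L)) := by
  have hg : ∀ i, AEStronglyMeasurable (f.rgrad w i) (volume.restrict (strip L)) := fun i =>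
    ((f.memLp_grad i).const_smul (scale w i)).aestronglyMeasurable
  have hh : MemLp (f.rhess w i j) 2 (volume.restrict (strip L)) :=
    (f.memLp_hess i j).const_smul (scale w i * scale w j)
  have hc : AEStronglyMeasurable (fun x => cross (f.rgrad w 0 x) (f.rgrad w 1 x))
      (volume.restrict (strip L)) :=
    Continuous.comp_aestronglyMeasurable (g := fun z : E3 × E3 => cross z.1 z.2)
      (f := fun x => (f.rgrad w 0 x, f.rgrad w 1 x)) continuous_cross ((hg 0).prodMk (hg 1))
  have hν : AEStronglyMeasurable (f.normal w) (volume.restrict (strip L)) := by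
    have h1 : AEStronglyMeasurable (fun x => ‖cross (f.rgrad w 0 x) (f.rgrad w 1 x)‖⁻¹)
        (volume.restrict (strip L)) := hc.norm.aemeasurable.inv.aestronglyMeasurable
    exact h1.smul hc
  have hin : AEStronglyMeasurable (fun x => inner ℝ (f.rhess w i j x) (f.normal w x))
      (volume.restrict (strip L)) := hh.aestronglyMeasurable.inner hν
  have hle : ∀ x, ‖(inner ℝ (f.rhess w i j x) (f.normal w x) : ℝ)‖ ≤ ‖f.rhess w i j x‖ := fun x =>
    (norm_inner_le_norm _ _).trans
      (mul_le_of_le_one_right (norm_nonneg _) (norm_unitNormal_le _ _))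
  have := hh.mono hin (Eventually.of_forall hle)
  simpa only [secondForm, Matrix.of_apply] using this

/-- The squared Frobenius distance `|II^w_f - II⁰|²`. -/
noncomputable def deficit (n : ℝ) (x : ℝ × ℝ) : ℝ :=
  ∑ i, ∑ j, (f.secondForm w x i j - refSecond n (x.1, 0) i j) ^ 2

theorem deficit_eq (n : ℝ) (x : ℝ × ℝ) : f.deficit w n x =
    f.secondForm w x 0 0 ^ 2 + f.secondForm w x 0 1 ^ 2
      + f.secondForm w x 1 0 ^ 2 + (f.secondForm w x 1 1 - n) ^ 2 := by
  simp [deficit, Fin.sum_univ_two, refSecond]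
  ring

theorem deficit_nonneg (n : ℝ) (x : ℝ × ℝ) : 0 ≤ f.deficit w n x :=
  Finset.sum_nonneg fun _ _ => Finset.sum_nonneg fun _ _ => sq_nonneg _

theorem integrable_deficit (n : ℝ) :
    Integrable (f.deficit w n) (volume.restrict (strip L)) :=
  integrable_finsetSum _ fun i _ => integrable_finsetSum _ fun j _ =>
    ((f.memLp_secondForm w i j).sub (memLp_const _)).integrable_sq

end W22

/-- A nonnegative bump function supported in the strip. -/
theorem exists_bump_strip {L : ℝ} (hL : 0 < L) : ∃ φ : ℝ × ℝ → ℝ, ContDiff ℝ ∞ φ ∧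
    HasCompactSupport φ ∧ tsupport φ ⊆ strip L ∧ 0 < ∫ x in strip L, φ x := by
  have hc : ((L / 2, 0) : ℝ × ℝ) ∈ strip L := by
    constructor <;> constructor <;> norm_num <;> linarith
  obtain ⟨r, hr, hrs⟩ := Metric.isOpen_iff.1 (isOpen_strip L) _ hc
  let ρ : ContDiffBump ((L / 2, 0) : ℝ × ℝ) := ⟨r / 4, r / 2, by positivity, by linarith⟩
  have hsub : tsupport ρ ⊆ strip L := by
    rw [ρ.tsupport_eq]
    exact (Metric.closedBall_subset_ball (by change r / 2 < r; linarith)).trans hrs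
  refine ⟨ρ, ρ.contDiff, ρ.hasCompactSupport, hsub, ?_⟩
  rw [setIntegral_eq_integral_of_forall_compl_eq_zero]
  · exact ρ.integral_pos
  · exact fun x hx => image_eq_zero_of_notMem_tsupport fun h => hx (hsub h)

/-- Trades a linear error for a large multiple of the quadratic deficit plus a constant `s` that can
be made small. -/
theorem abs_le_sq_div_add {a s D : ℝ} (hs : 0 < s) (h : a ^ 2 ≤ D) : |a| ≤ D / s + s := by
  have h1 : |a| ≤ a ^ 2 / s + s := by
    rw [div_add' _ _ _ hs.ne', le_div_iff₀ hs]
    nlinarith [sq_nonneg (|a| - s), sq_abs a, abs_nonneg a]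
  have h2 : a ^ 2 / s ≤ D / s := div_le_div_of_nonneg_right h hs.le
  linarith

/-- The pointwise estimate behind the lower bound. -/
theorem abs_remainder_le {κ n w s M g y a b c φ₀ φ₁ φ₂ D : ℝ} (hn : n ≠ 0) (hs : 0 < s)
    (hw : 0 < w) (hw1 : w ≤ 1) (hy : |y| ≤ 1) (hκw : |κ * w| ≤ 1 / 2) (hg : g = 1 - κ * (w * y))
    (h₀ : |φ₀| ≤ M) (h₁ : |φ₁| ≤ M) (h₂ : |φ₂| ≤ M)
    (hdet : a * (n + c) = b ^ 2) (hD : D = a ^ 2 + b ^ 2 + b ^ 2 + c ^ 2) :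
    |-(g * (φ₁ * b - w⁻¹ * φ₂ * a)) - φ₀ * (2 * κ * a + κ * n * (g ^ 2 - 1) + κ * g ^ 2 * c)|
      ≤ M * (2 + 5 * |κ| + 3 * κ ^ 2 * |n|) * ((2 / s + w⁻¹ / |n|) * D + (2 * s + w)) := by
  -- Here `a`, `b`, `c` play the roles of `II₁₁`, `II₁₂`, `II₂₂ - n`, and `φ₀`, `φ₁`, `φ₂` those of
  -- the test function and its partial derivatives at a point.
  have hM : 0 ≤ M := (abs_nonneg _).trans h₀
  have hn' : 0 < |n| := abs_pos.2 hn
  have hw' : 0 < w⁻¹ := inv_pos.2 hw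
  have hwi : 1 ≤ w⁻¹ := (one_le_inv₀ hw).2 hw1
  -- The decisive gain: by Gauss's equation `a n = b² - a c`, so `a` is quadratic in the deficit and
  -- can afford the factor `w⁻¹`.
  have ha : |a| ≤ D / |n| := by
    rw [le_div_iff₀ hn', ← abs_mul]
    have : a * n = b ^ 2 - a * c := by linarith
    rw [this, abs_le]
    constructor <;> nlinarith [sq_nonneg (a - c), sq_nonneg (a + c), sq_nonneg b]
  have hb : |b| ≤ D / s + s := abs_le_sq_div_add hs (by nlinarith [sq_nonneg a, sq_nonneg b, sq_nonneg c])
  have hc : |c| ≤ D / s + s := abs_le_sq_div_add hs (by nlinarith [sq_nonneg a, sq_nonneg b])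
  have hz : |κ * (w * y)| ≤ |κ| * w := by
    rw [abs_mul, abs_mul, abs_of_pos hw, ← mul_assoc]
    exact mul_le_of_le_one_right (by positivity) hy
  have hz2 : |κ| * w ≤ 1 / 2 := by rwa [abs_mul, abs_of_pos hw] at hκw
  have hg1 : |g| ≤ 3 / 2 := by
    have := abs_le.1 (hz.trans hz2)
    rw [abs_le]; constructor <;> linarith [this.1, this.2]
  have hg2 : |g ^ 2| ≤ 9 / 4 := by
    rw [abs_pow]; nlinarith [abs_nonneg g]
  have hg3 : |g ^ 2 - 1| ≤ 3 * (|κ| * w) := by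
    have e : g ^ 2 - 1 = -(κ * (w * y)) * (g + 1) := by rw [hg]; ring
    have h1 : |g + 1| ≤ 3 := by
      have := abs_le.1 hg1
      rw [abs_le]; constructor <;> linarith [this.1, this.2]
    rw [e, abs_mul, abs_neg]
    calc _ ≤ |κ| * w * 3 := mul_le_mul hz h1 (abs_nonneg _) (by positivity)
      _ = _ := by ring
  -- The last summand `w` accounts for `g² - 1`, the deviation of the metric from its midline value.
  set X := |b| + |c| + w⁻¹ * |a| + w with hX
  have hX0 : 0 ≤ X := by positivity
  have t1 : |g * (φ₁ * b - w⁻¹ * φ₂ * a)| ≤ 2 * M * X := by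
    have : |φ₁ * b - w⁻¹ * φ₂ * a| ≤ M * |b| + w⁻¹ * M * |a| := by
      refine (abs_sub _ _).trans ?_
      rw [abs_mul, abs_mul, abs_mul, abs_of_pos hw']
      gcongr
    rw [abs_mul]
    calc |g| * |φ₁ * b - w⁻¹ * φ₂ * a| ≤ 2 * (M * |b| + w⁻¹ * M * |a|) := by
          gcongr; linarith
      _ = 2 * M * (|b| + w⁻¹ * |a|) := by ring
      _ ≤ 2 * M * X := by
          have := abs_nonneg c
          gcongr; rw [hX]; linarith
  have t2 : |φ₀ * (2 * κ * a + κ * n * (g ^ 2 - 1) + κ * g ^ 2 * c)|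
      ≤ M * (5 * |κ| + 3 * κ ^ 2 * |n|) * X := by
    have h1 : |2 * κ * a| ≤ 5 * |κ| * (w⁻¹ * |a|) := by
      rw [abs_mul, abs_mul, abs_two]
      exact mul_le_mul (by linarith [abs_nonneg κ]) (le_mul_of_one_le_left (abs_nonneg a) hwi)
        (abs_nonneg a) (by positivity)
    have h2 : |κ * n * (g ^ 2 - 1)| ≤ 3 * κ ^ 2 * |n| * w := by
      rw [abs_mul, abs_mul, ← sq_abs κ]
      calc _ ≤ |κ| * |n| * (3 * (|κ| * w)) := by gcongr
        _ = _ := by ring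
    have h3 : |κ * g ^ 2 * c| ≤ 5 * |κ| * |c| := by
      rw [abs_mul, abs_mul]
      calc _ ≤ |κ| * 5 * |c| := by gcongr; linarith
        _ = _ := by ring
    have h4 := abs_add_three (2 * κ * a) (κ * n * (g ^ 2 - 1)) (κ * g ^ 2 * c)
    have h5 : 0 ≤ 5 * |κ| := by positivity
    have h6 : 0 ≤ 3 * κ ^ 2 * |n| := by positivity
    rw [abs_mul, mul_assoc M]
    refine mul_le_mul h₀ ?_ (abs_nonneg _) hM
    have h7 : w⁻¹ * |a| + |c| ≤ X := by rw [hX]; linarith [abs_nonneg b]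
    have h8 : w ≤ X := by
      rw [hX]
      have : 0 ≤ w⁻¹ * |a| := by positivity
      linarith [abs_nonneg b, abs_nonneg c]
    have h9 := mul_le_mul_of_nonneg_left h7 h5
    have h10 := mul_le_mul_of_nonneg_left h8 h6
    rw [mul_add] at h9
    rw [add_mul]
    linarith
  have t3 : X ≤ (2 / s + w⁻¹ / |n|) * D + (2 * s + w) := by
    have : w⁻¹ * |a| ≤ w⁻¹ * (D / |n|) := by gcongr
    calc X ≤ (D / s + s) + (D / s + s) + w⁻¹ * (D / |n|) + w := by rw [hX]; gcongr
      _ = _ := by ring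
  calc _ ≤ 2 * M * X + M * (5 * |κ| + 3 * κ ^ 2 * |n|) * X := by
        refine (abs_sub _ _).trans ?_
        rw [abs_neg]
        exact add_le_add t1 t2
    _ = M * (2 + 5 * |κ| + 3 * κ ^ 2 * |n|) * X := by ring
    _ ≤ _ := by gcongr

/-- The second fundamental forms of rescaled isometries stay away from `II⁰`: their squared
distance in `L²` is at least of the order of the width. -/
theorem exists_le_integral_deficit {L κ n : ℝ} (hL : 0 < L) (hκ : κ ≠ 0) (hn : n ≠ 0) :
    ∃ c : ℝ, 0 < c ∧ ∃ w₀ : ℝ, 0 < w₀ ∧ ∀ w : ℝ, 0 < w → w < w₀ → ∀ f : W22 L,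
      IsRescaledIsometry κ w f → c * w ≤ ∫ x in strip L, f.deficit w n x := by
  obtain ⟨φ, hφ, hφc, hφΩ, hm⟩ := exists_bump_strip hL
  set m := ∫ x in strip L, φ x with hm_def
  have hd : ∀ d, Continuous fun x => fderiv ℝ φ x d := fun d =>
    (contDiff_fderiv_dir hφ d).continuous
  have hdc : ∀ d, HasCompactSupport fun x => fderiv ℝ φ x d := fun d =>
    hasCompactSupport_fderiv_dir hφc d
  obtain ⟨M₀, hM₀⟩ := hφc.exists_bound_of_continuous hφ.continuous
  obtain ⟨M₁, hM₁⟩ := (hdc (1, 0)).exists_bound_of_continuous (hd (1, 0))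
  obtain ⟨M₂, hM₂⟩ := (hdc (0, 1)).exists_bound_of_continuous (hd (0, 1))
  set M := max 1 (max M₀ (max M₁ M₂)) with hM_def
  have hM : 0 < M := lt_of_lt_of_le one_pos (le_max_left _ _)
  have hκ' : 0 < |κ| := abs_pos.2 hκ
  have hn' : 0 < |n| := abs_pos.2 hn
  set C := M * (2 + 5 * |κ| + 3 * κ ^ 2 * |n|) with hC_def
  have hC : 0 < C := by positivity
  -- Chosen so that `C * L * (3 * s)` is half of `|κ n| m`: as `w ≤ s`, the constant errors `2 * s +
  -- w` use up at most half of the main term.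
  set s := |κ * n| * m / (6 * C * L) with hs_def
  have hκn : 0 < |κ * n| := abs_pos.2 (mul_ne_zero hκ hn)
  have hs : 0 < s := by positivity
  refine ⟨|κ * n| * m / (2 * C * (2 + 1 / |n|)), by positivity, min (min 1 s) (1 / (2 * |κ|)),
    by positivity, fun w hw hww f hf => ?_⟩
  have hw1 : w ≤ 1 := hww.le.trans ((min_le_left _ _).trans (min_le_left _ _))
  have hws : w ≤ s := hww.le.trans ((min_le_left _ _).trans (min_le_right _ _))
  have hκw : |κ * w| ≤ 1 / 2 := by
    have := hww.le.trans (min_le_right _ _)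
    rw [le_div_iff₀ (by positivity)] at this
    rw [abs_mul, abs_of_pos hw]
    linarith
  have hκw1 : |κ * w| < 1 := by linarith
  -- The remainder left in Codazzi's equation when the main term `κ n φ` is isolated; its integral
  -- is therefore `κ n m`.
  set R : ℝ × ℝ → ℝ := fun x =>
    -((1 - κ * (w * x.2)) * (fderiv ℝ φ x (1, 0) * f.secondForm w x 0 1
          - w⁻¹ * fderiv ℝ φ x (0, 1) * f.secondForm w x 0 0))
      - φ x * (2 * κ * f.secondForm w x 0 0 + κ * n * ((1 - κ * (w * x.2)) ^ 2 - 1)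
        + κ * (1 - κ * (w * x.2)) ^ 2 * (f.secondForm w x 1 1 - n)) with hR
  have hbd : ∀ {ψ : ℝ × ℝ → ℝ}, Continuous ψ → HasCompactSupport ψ → ∀ i j,
      IntegrableOn (fun x => ψ x * f.secondForm w x i j) (strip L) := fun h1 h2 i j =>
    integrable_mul_of_continuous h1 h2 (f.memLp_secondForm w i j)
  have hRint : κ * n * m = ∫ x in strip L, R x := by
    have hcod := f.codazzi hw hκw1 hf hφ hφc hφΩ
    have hgc : Continuous fun x : ℝ × ℝ => 1 - κ * (w * x.2) := by fun_prop
    set F₁ : ℝ × ℝ → ℝ := fun x => (1 - κ * (w * x.2)) * (fderiv ℝ φ x (1, 0) *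
        f.secondForm w x 0 1 - w⁻¹ * fderiv ℝ φ x (0, 1) * f.secondForm w x 0 0)
    set F₂ : ℝ × ℝ → ℝ := fun x => φ x * (2 * κ * f.secondForm w x 0 0
        + κ * (1 - κ * (w * x.2)) ^ 2 * f.secondForm w x 1 1)
    have i1 : IntegrableOn F₁ (strip L) := by
      have := (hbd (hgc.mul (hd (1, 0))) (hdc (1, 0)).mul_left 0 1).sub
        ((hbd (hgc.mul (hd (0, 1))) (hdc (0, 1)).mul_left 0 0).const_mul w⁻¹)
      refine this.congr (Eventually.of_forall fun x => ?_)
      simp only [F₁, Pi.sub_apply, Pi.mul_apply]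
      ring
    have i2 : IntegrableOn F₂ (strip L) := by
      have := ((hbd hφ.continuous hφc 0 0).const_mul (2 * κ)).add
        ((hbd (hφ.continuous.mul (hgc.pow 2)) hφc.mul_right 1 1).const_mul κ)
      refine this.congr (Eventually.of_forall fun x => ?_)
      simp only [F₂, Pi.add_apply, Pi.mul_apply, Pi.pow_apply]
      ring
    have i3 : IntegrableOn (fun x => κ * n * φ x) (strip L) :=
      (integrableOn_strip_of_continuous hφ.continuous).const_mul _
    have e : ∀ x, R x = -F₁ x - F₂ x + κ * n * φ x := by
      intro x
      simp only [hR, F₁, F₂]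
      ring
    rw [integral_congr_ae (Eventually.of_forall e),
      integral_add (show Integrable (fun x => -F₁ x - F₂ x) (volume.restrict (strip L)) from i1.neg.sub i2)
        (show Integrable (fun x => κ * n * φ x) (volume.restrict (strip L)) from i3),
      integral_sub (show Integrable (fun x => -F₁ x) (volume.restrict (strip L)) from i1.neg) i2, integral_neg,
      integral_const_mul, ← hm_def, hcod]
    ring
  have hpt : ∀ᵐ x ∂(volume.restrict (strip L)),
      ‖R x‖ ≤ C * ((2 / s + w⁻¹ / |n|) * f.deficit w n x + (2 * s + w)) := by
    filter_upwards [f.det_secondForm hw hκw1 hf, f.secondForm_symm (w := w),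
      ae_restrict_mem (isOpen_strip L).measurableSet] with x hx hsym hxs
    have hy : |x.2| ≤ 1 := by
      have := hxs.2
      rw [abs_le]
      constructor <;> linarith [this.1, this.2]
    refine abs_remainder_le hn hs hw hw1 hy hκw rfl ?_ ?_ ?_ ?_ ?_
    · exact (hM₀ x).trans ((le_max_left _ _).trans (le_max_right _ _))
    · exact (hM₁ x).trans ((le_max_left _ _).trans ((le_max_right _ _).trans (le_max_right _ _)))
    · exact (hM₂ x).trans ((le_max_right _ _).trans ((le_max_right _ _).trans (le_max_right _ _)))
    · rw [add_sub_cancel, hx]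
    · rw [f.deficit_eq, hsym]
  have hvol : (volume.restrict (strip L)).real univ = L := by
    rw [Measure.real, Measure.restrict_apply_univ, volume_strip, ENNReal.toReal_ofReal hL.le]
  have hi : Integrable (fun x => C * ((2 / s + w⁻¹ / |n|) * f.deficit w n x + (2 * s + w)))
      (volume.restrict (strip L)) :=
    (((f.integrable_deficit w n).const_mul _).add (integrable_const _)).const_mul _
  have hfin := norm_integral_le_of_norm_le hi hpt
  rw [← hRint, integral_const_mul, integral_add ((f.integrable_deficit w n).const_mul _)
    (integrable_const _), integral_const_mul, integral_const, hvol, smul_eq_mul, Real.norm_eq_abs,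
    abs_mul _ m, abs_of_pos hm] at hfin
  set I := ∫ x in strip L, f.deficit w n x with hI
  have hI0 : 0 ≤ I := integral_nonneg fun x => f.deficit_nonneg w n x
  have h1 : C * (L * (2 * s + w)) ≤ |κ * n| * m / 2 := by
    have : C * (L * (3 * s)) = |κ * n| * m / 2 := by
      rw [hs_def]; field_simp; norm_num
    rw [← this]
    gcongr
    linarith
  have h2 : |κ * n| * m / 2 ≤ C * (2 / s + w⁻¹ / |n|) * I := by linarith
  -- Multiplication by `w` clears `w⁻¹`, and `w / s ≤ 1` makes the coefficient of `I` independent of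
  -- `w`.
  have h3 : |κ * n| * m / 2 * w ≤ C * (2 + 1 / |n|) * I := by
    calc _ ≤ C * (2 / s + w⁻¹ / |n|) * I * w := by gcongr
      _ = C * (2 * (w / s) + 1 / |n|) * I := by field_simp
      _ ≤ C * (2 * 1 + 1 / |n|) * I := by
          gcongr
          exact (div_le_one hs).2 hws
      _ = _ := by ring
  rw [div_mul_eq_mul_div, div_le_iff₀ (by positivity)]
  linarith

end LowerBound

/-! ### Second-order expansion at a minimum -/

section Taylor

/-- At a zero of a nonnegative function of class `C²` the second difference quotients converge to
half the second derivative. -/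
theorem tendsto_div_sq_of_contDiffAt {V : Type*} [NormedAddCommGroup V] [NormedSpace ℝ V]
    {F : V → ℝ} {a : V} (hF : ContDiffAt ℝ 2 F a) (h0 : F a = 0) (hnn : ∀ x, 0 ≤ F x) (b : V) :
    Tendsto (fun t : ℝ => F (a + t • b) / t ^ 2) (𝓝[>] 0)
      (𝓝 (1 / 2 * iteratedFDeriv ℝ 2 F a ![b, b])) := by
  -- A zero of a nonnegative function is a minimum, so the first-order term vanishes and a single
  -- use of l'Hôpital's rule reaches the second derivative.
  have hmin : IsLocalMin F a := Eventually.of_forall fun x => by rw [h0]; exact hnn x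
  have hd0 : fderiv ℝ F a = 0 := hmin.fderiv_eq_zero
  have hline : ∀ t : ℝ, HasDerivAt (fun t : ℝ => a + t • b) b t := fun t => by
    simpa using ((hasDerivAt_id t).smul_const b).const_add a
  have hcont : ContinuousAt (fun t : ℝ => a + t • b) 0 := (hline 0).continuousAt
  have hev : ∀ᶠ x in 𝓝 a, DifferentiableAt ℝ F x := by
    filter_upwards [hF.eventually (by simp)] with x hx
    exact hx.differentiableAt (by simp)
  have hev' : ∀ᶠ t : ℝ in 𝓝 0, DifferentiableAt ℝ F (a + t • b) := by
    apply hcont.eventually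
    simpa using hev
  have hder : ∀ᶠ t : ℝ in 𝓝 0, HasDerivAt (fun t : ℝ => F (a + t • b))
      (fderiv ℝ F (a + t • b) b) t := by
    filter_upwards [hev'] with t ht
    exact ht.hasFDerivAt.comp_hasDerivAt t (hline t)
  have hd2 : HasDerivAt (fun t : ℝ => fderiv ℝ F (a + t • b) b)
      (iteratedFDeriv ℝ 2 F a ![b, b]) 0 := by
    have h1 : DifferentiableAt ℝ (fderiv ℝ F) a :=
      (hF.fderiv_right (m := 1) (by norm_num)).differentiableAt (by simp)
    have h2 : HasFDerivAt (fderiv ℝ F) (fderiv ℝ (fderiv ℝ F) a) (a + (0 : ℝ) • b) := by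
      simpa using h1.hasFDerivAt
    have h3 : HasDerivAt (fun t : ℝ => fderiv ℝ F (a + t • b)) (fderiv ℝ (fderiv ℝ F) a b) 0 :=
      HasFDerivAt.comp_hasDerivAt (f := fun t : ℝ => a + t • b) (0 : ℝ) h2 (hline 0)
    have h4 := h3.clm_apply (hasDerivAt_const (0 : ℝ) b)
    rw [iteratedFDeriv_two_apply]
    simpa using h4
  have hslope : Tendsto (fun t : ℝ => fderiv ℝ F (a + t • b) b / (2 * t)) (𝓝[>] 0)
      (𝓝 (1 / 2 * iteratedFDeriv ℝ 2 F a ![b, b])) := by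
    have h1 := (hasDerivAt_iff_tendsto_slope.1 hd2).mono_left
      (nhdsWithin_mono 0 fun t (ht : 0 < t) => ht.ne' : 𝓝[>] (0 : ℝ) ≤ 𝓝[≠] 0)
    refine (h1.const_mul (1 / 2)).congr' ?_
    filter_upwards [self_mem_nhdsWithin] with t ht
    simp [slope_def_field, hd0]
    field_simp
  refine HasDerivAt.lhopital_zero_nhdsGT (f' := fun t => fderiv ℝ F (a + t • b) b)
    (g' := fun t : ℝ => 2 * t) (hder.filter_mono nhdsWithin_le_nhds) ?_ ?_ ?_ ?_ hslope
  · refine Eventually.of_forall fun t => ?_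
    simpa using hasDerivAt_pow 2 t
  · filter_upwards [self_mem_nhdsWithin] with t ht
    exact mul_ne_zero two_ne_zero (ne_of_gt ht)
  · have := (hder.self_of_nhds.continuousAt.tendsto).mono_left
      (nhdsWithin_le_nhds (s := Ioi (0 : ℝ)))
    simpa [h0] using this
  · have : ContinuousAt (fun t : ℝ => t ^ 2) 0 := by fun_prop
    simpa using this.tendsto.mono_left (nhdsWithin_le_nhds (s := Ioi (0 : ℝ)))

end Taylor

/-! ### Coercivity of the quadratic form `𝒬₃` -/

section Density

attribute [local instance] Matrix.frobeniusNormedAddCommGroup Matrix.frobeniusNormedSpace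

theorem frobenius_norm_sq {m n : Type*} [Fintype m] [Fintype n] (A : Matrix m n ℝ) :
    ‖A‖ ^ 2 = ∑ i, ∑ j, A i j ^ 2 := by
  rw [Matrix.frobenius_norm_def, ← Real.sqrt_eq_rpow, Real.sq_sqrt (by positivity)]
  simp

theorem frobenius_norm_sq_eq_trace {n : Type*} [Fintype n] (A : Matrix n n ℝ) :
    ‖A‖ ^ 2 = (Aᵀ * A).trace := by
  rw [frobenius_norm_sq, Finset.sum_comm]
  simp [Matrix.trace, Matrix.mul_apply, sq]

theorem transpose_mul_self_of_mem_rotations {R : Matrix (Fin 3) (Fin 3) ℝ} (hR : R ∈ rotations) :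
    Rᵀ * R = 1 := by
  have h : R ∈ Matrix.specialOrthogonalGroup (Fin 3) ℝ := hR
  rw [Matrix.mem_specialOrthogonalGroup_iff, Matrix.mem_orthogonalGroup_iff'] at h
  exact h.1

theorem norm_le_two_of_mem_rotations {R : Matrix (Fin 3) (Fin 3) ℝ} (hR : R ∈ rotations) :
    ‖R‖ ≤ 2 := by
  have h : ‖R‖ ^ 2 = 3 := by
    rw [frobenius_norm_sq_eq_trace, transpose_mul_self_of_mem_rotations hR]
    simp
  nlinarith [norm_nonneg R]

theorem one_mem_rotations : (1 : Matrix (Fin 3) (Fin 3) ℝ) ∈ rotations :=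
  (Matrix.specialOrthogonalGroup (Fin 3) ℝ).one_mem

/-- The strain `AᵀA - 1` controls the distance to the rotations from below. -/
theorem norm_transpose_mul_self_sub_one_le (A : Matrix (Fin 3) (Fin 3) ℝ) :
    ‖Aᵀ * A - 1‖ ≤ Metric.infDist A rotations * (‖A‖ + 2) := by
  have hpos : 0 < ‖A‖ + 2 := by positivity
  rw [← div_le_iff₀ hpos]
  refine (Metric.le_infDist ⟨1, one_mem_rotations⟩).2 fun R hR => ?_
  rw [div_le_iff₀ hpos, dist_eq_norm]
  -- Replacing `1` by `RᵀR` makes the strain linear in `A - R`.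
  have e : Aᵀ * A - 1 = (A - R)ᵀ * A + Rᵀ * (A - R) := by
    rw [← transpose_mul_self_of_mem_rotations hR, Matrix.transpose_sub]
    noncomm_ring
  calc ‖Aᵀ * A - 1‖ ≤ ‖(A - R)ᵀ * A‖ + ‖Rᵀ * (A - R)‖ := by rw [e]; exact norm_add_le _ _
    _ ≤ ‖A - R‖ * ‖A‖ + 2 * ‖A - R‖ := by
        refine add_le_add ?_ ?_
        · refine (Matrix.frobenius_norm_mul (A - R)ᵀ A).trans ?_
          rw [Matrix.frobenius_norm_transpose]
        · refine (Matrix.frobenius_norm_mul Rᵀ (A - R)).trans ?_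
          rw [Matrix.frobenius_norm_transpose]
          exact mul_le_mul_of_nonneg_right (norm_le_two_of_mem_rotations hR) (norm_nonneg _)
    _ = _ := by ring

/-- Coercivity of `𝒬₃` on symmetric matrices. -/
theorem IsEnergyDensity.exists_le_Q3 {𝒲 : Matrix (Fin 3) (Fin 3) ℝ → ℝ≥0∞}
    (h : IsEnergyDensity 𝒲) : ∃ c : ℝ, 0 < c ∧ ∀ B : Matrix (Fin 3) (Fin 3) ℝ,
      c * ‖B + Bᵀ‖ ^ 2 ≤ Q3 𝒲 B := by
  obtain ⟨c, hc, hcoer⟩ := h.coercive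
  obtain ⟨U, hU, hUR, hfin, hsm⟩ := h.regular
  have h1U : (1 : Matrix (Fin 3) (Fin 3) ℝ) ∈ U := hUR one_mem_rotations
  set F : Matrix (Fin 3) (Fin 3) ℝ → ℝ := fun A => (𝒲 A).toReal with hFdef
  have hF : ContDiffAt ℝ 2 F 1 := hsm.contDiffAt (hU.mem_nhds h1U)
  have hF0 : F 1 = 0 := by simp [hFdef, (h.eq_zero_iff 1).2 one_mem_rotations]
  -- `𝒬₃(B)` is the limit of `𝒲(1 + tB) / t²`. Coercivity bounds this below by the squared strain of
  -- `1 + tB`, whose leading part is `t (B + Bᵀ)`; the denominator is the limit of `‖1 + tB‖ + 2`.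
  refine ⟨c / (‖(1 : Matrix (Fin 3) (Fin 3) ℝ)‖ + 2) ^ 2, by positivity, fun B => ?_⟩
  have hlim := tendsto_div_sq_of_contDiffAt hF hF0 (fun A => ENNReal.toReal_nonneg) B
  have hlim2 : Tendsto (fun t : ℝ => c * (‖B + Bᵀ + t • (Bᵀ * B)‖ / (‖1 + t • B‖ + 2)) ^ 2)
      (𝓝[>] 0) (𝓝 (c * (‖B + Bᵀ‖ / (‖(1 : Matrix (Fin 3) (Fin 3) ℝ)‖ + 2)) ^ 2)) := by
    have hne : ∀ t : ℝ, ‖1 + t • B‖ + 2 ≠ 0 := fun t => by positivity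
    have : Continuous fun t : ℝ =>
        c * (‖B + Bᵀ + t • (Bᵀ * B)‖ / (‖1 + t • B‖ + 2)) ^ 2 := by
      fun_prop (disch := exact hne _)
    have := (this.tendsto 0).mono_left (nhdsWithin_le_nhds (s := Ioi (0 : ℝ)))
    simpa using this
  have hUev : ∀ᶠ t : ℝ in 𝓝[>] 0, 1 + t • B ∈ U := by
    have : Continuous fun t : ℝ => 1 + t • B := by fun_prop
    refine ((this.tendsto 0).mono_left nhdsWithin_le_nhds).eventually ?_
    simpa using hU.mem_nhds h1U
  have hle := le_of_tendsto_of_tendsto hlim2 hlim ?_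
  · calc _ = c * (‖B + Bᵀ‖ / (‖(1 : Matrix (Fin 3) (Fin 3) ℝ)‖ + 2)) ^ 2 := by
          rw [div_pow]; ring
      _ ≤ _ := hle
  · filter_upwards [self_mem_nhdsWithin, hUev] with t (ht : 0 < t) htU
    set A := 1 + t • B with hA
    have e1 : Aᵀ * A - 1 = t • (B + Bᵀ + t • (Bᵀ * B)) := by
      rw [hA, Matrix.transpose_add, Matrix.transpose_one, Matrix.transpose_smul, add_mul, mul_add,
        mul_add, one_mul, one_mul, mul_one, Matrix.smul_mul, Matrix.mul_smul]
      module
    have e2 := norm_transpose_mul_self_sub_one_le A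
    rw [e1, norm_smul, Real.norm_of_nonneg ht.le] at e2
    have hpos : 0 < ‖A‖ + 2 := by positivity
    have e3 : t * (‖B + Bᵀ + t • (Bᵀ * B)‖ / (‖A‖ + 2)) ≤ Metric.infDist A rotations := by
      rw [← mul_div_assoc, div_le_iff₀ hpos]
      exact e2
    have e4 : c * Metric.infDist A rotations ^ 2 ≤ F A :=
      (ENNReal.ofReal_le_iff_le_toReal (hfin A htU)).1 (hcoer A)
    rw [le_div_iff₀ (by positivity)]
    calc _ = c * (t * (‖B + Bᵀ + t • (Bᵀ * B)‖ / (‖A‖ + 2))) ^ 2 := by ring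
      _ ≤ c * Metric.infDist A rotations ^ 2 := by gcongr
      _ ≤ F A := e4

/-- Congruence by a matrix `A` distorts the symmetric part at most by the factor `‖A‖²`. -/
theorem norm_symm_le_of_congr {A G : Matrix (Fin 3) (Fin 3) ℝ} (hA : IsUnit A.det) :
    ‖G + Gᵀ‖ ≤ ‖A‖ ^ 2 * ‖(A⁻¹)ᵀ * G * A⁻¹ + ((A⁻¹)ᵀ * G * A⁻¹)ᵀ‖ := by
  have e1 : A⁻¹ * A = 1 := Matrix.nonsing_inv_mul A hA
  have e2 : Aᵀ * (A⁻¹)ᵀ = 1 := by rw [← Matrix.transpose_mul, e1, Matrix.transpose_one]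
  have e : G + Gᵀ = Aᵀ * ((A⁻¹)ᵀ * G * A⁻¹ + ((A⁻¹)ᵀ * G * A⁻¹)ᵀ) * A := by
    have : ((A⁻¹)ᵀ * G * A⁻¹)ᵀ = (A⁻¹)ᵀ * Gᵀ * A⁻¹ := by
      simp [Matrix.transpose_mul, Matrix.mul_assoc]
    rw [this, ← add_mul, ← mul_add]
    calc G + Gᵀ = (Aᵀ * (A⁻¹)ᵀ) * (G + Gᵀ) * (A⁻¹ * A) := by rw [e1, e2, one_mul, mul_one]
      _ = _ := by simp only [Matrix.mul_assoc]
  set H := (A⁻¹)ᵀ * G * A⁻¹ + ((A⁻¹)ᵀ * G * A⁻¹)ᵀ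
  calc ‖G + Gᵀ‖ = ‖Aᵀ * H * A‖ := by rw [← e]
    _ ≤ ‖Aᵀ‖ * ‖H‖ * ‖A‖ := (Matrix.frobenius_norm_mul _ _).trans
        (mul_le_mul_of_nonneg_right (Matrix.frobenius_norm_mul _ _) (norm_nonneg _))
    _ = _ := by rw [Matrix.frobenius_norm_transpose]; ring

theorem norm_submatrix_castSucc_le (G : Matrix (Fin 3) (Fin 3) ℝ) :
    ‖G.submatrix Fin.castSucc (Fin.castSucc : Fin 2 → Fin 3)‖ ≤ ‖G‖ := by
  refine (pow_le_pow_iff_left₀ (norm_nonneg _) (norm_nonneg _) two_ne_zero).1 ?_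
  rw [frobenius_norm_sq, frobenius_norm_sq]
  simp [Fin.sum_univ_three, Fin.sum_univ_two]
  nlinarith [sq_nonneg (G 0 2), sq_nonneg (G 1 2), sq_nonneg (G 2 0), sq_nonneg (G 2 1),
    sq_nonneg (G 2 2)]

end Density

/-! ### The Euclidean mid-surface and the prestrain -/

section Prestrain

variable {κ n : ℝ} {R : Matrix (Fin 3) (Fin 3) ℝ}

theorem inner_col_of_mem_rotations (hR : R ∈ rotations) (i j : Fin 3) :
    inner ℝ (WithLp.toLp 2 (R.col i) : E3) (WithLp.toLp 2 (R.col j)) = if i = j then 1 else 0 := by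
  have h := congrFun (congrFun (transpose_mul_self_of_mem_rotations hR) i) j
  rw [Matrix.one_apply] at h
  rw [E3.inner_eq_sum, ← h, Matrix.mul_apply]
  rfl

theorem inner_frame (hR : R ∈ rotations) (s : ℝ) (i j : Fin 3) :
    inner ℝ (frame κ R s i) (frame κ R s j) = if i = j then 1 else 0 := by
  have h := inner_col_of_mem_rotations hR
  have hcs := Real.sin_sq_add_cos_sq (κ * s)
  fin_cases i <;> fin_cases j <;>
    simp only [frame, Fin.zero_eta, Fin.mk_one, Fin.reduceFinMk, Matrix.cons_val, inner_add_left,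
      inner_add_right, real_inner_smul_left, real_inner_smul_right, h] <;>
    norm_num <;> first | linarith | simp

theorem continuous_frame_zero (κ : ℝ) (R : Matrix (Fin 3) (Fin 3) ℝ) :
    Continuous fun s => frame κ R s 0 := by
  rw [continuous_iff_continuousAt]
  exact fun s => (hasDerivAt_frame κ 0 R s).1.continuousAt

/-- The frame turns about the fixed axis `e₃`, so `∂₁Φ` stays parallel to `e₁`, while `∂₂Φ` lies in
the span of `e₂` and `e₃`. Nondegeneracy thus reduces to two scalar inequalities. -/
theorem hasDerivAt_midSurface_fst (κ n : ℝ) (R : Matrix (Fin 3) (Fin 3) ℝ) (z : ℝ × ℝ) :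
    HasDerivAt (fun s => midSurface κ n R (s, z.2))
      ((1 - κ * z.2 + 1 / 6 * κ * n ^ 2 * z.2 ^ 3) • frame κ R z.1 0) z.1 := by
  have hc := continuous_frame_zero κ R
  obtain ⟨h0, h1, h2⟩ := hasDerivAt_frame κ n R z.1
  have hi : HasDerivAt (fun s => ∫ r in (0 : ℝ)..s, frame κ R r 0) (frame κ R z.1 0) z.1 :=
    intervalIntegral.integral_hasDerivAt_right (hc.intervalIntegrable _ _)
      hc.stronglyMeasurable.stronglyMeasurableAtFilter hc.continuousAt
  have h := ((hi.add (h1.const_smul z.2)).add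
    (h2.const_smul (1 / 2 * z.2 ^ 2 * n))).sub
      (((h0.const_smul (0 : ℝ)).add (h1.const_smul n)).const_smul (1 / 6 * z.2 ^ 3 * n))
  refine h.congr_deriv ?_
  simp only [refSecond, Matrix.of_apply, Matrix.cons_val]
  module

theorem hasDerivAt_midSurface_snd (κ n : ℝ) (R : Matrix (Fin 3) (Fin 3) ℝ) (z : ℝ × ℝ) :
    HasDerivAt (fun t => midSurface κ n R (z.1, t))
      ((1 - 1 / 2 * n ^ 2 * z.2 ^ 2) • frame κ R z.1 1 + (n * z.2) • frame κ R z.1 2) z.2 := by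
  have p1 : HasDerivAt (fun t : ℝ => t) 1 z.2 := hasDerivAt_id _
  have p2 : HasDerivAt (fun t : ℝ => 1 / 2 * t ^ 2 * n) (n * z.2) z.2 := by
    refine (((hasDerivAt_pow 2 z.2).const_mul (1 / 2)).mul_const n).congr_deriv ?_
    norm_num; ring
  have p3 : HasDerivAt (fun t : ℝ => 1 / 6 * t ^ 3 * n) (1 / 2 * n * z.2 ^ 2) z.2 := by
    refine (((hasDerivAt_pow 3 z.2).const_mul (1 / 6)).mul_const n).congr_deriv ?_
    norm_num; ring
  have h := (((p1.smul_const (frame κ R z.1 1)).const_add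
    (∫ r in (0 : ℝ)..z.1, frame κ R r 0)).add (p2.smul_const (frame κ R z.1 2))).sub
    (p3.smul_const ((0 : ℝ) • frame κ R z.1 0 + n • frame κ R z.1 1))
  refine h.congr_deriv ?_
  module

theorem det_colMatrix_unitNormal (a b : E3) :
    (colMatrix a b (unitNormal a b)).det = ‖cross a b‖ := by
  have e : (colMatrix a b (unitNormal a b)).det = inner ℝ (cross a b) (unitNormal a b) := by
    rw [colMatrix, Matrix.det_fin_three, E3.inner_eq, cross_zero, cross_one, cross_two]
    simp
    ring
  rw [e, unitNormal, inner_smul_right, real_inner_self_eq_norm_sq]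
  rcases eq_or_ne ‖cross a b‖ 0 with h | h
  · simp [h]
  · field_simp

/-- The frame of the mid-surface is nondegenerate near the midline. -/
theorem isUnit_det_midFrame (hR : R ∈ rotations) {z : ℝ × ℝ}
    (h1 : 0 < 1 - κ * z.2 + 1 / 6 * κ * n ^ 2 * z.2 ^ 3) (h2 : 0 < 1 - 1 / 2 * n ^ 2 * z.2 ^ 2) :
    IsUnit (midFrame κ n R z).det := by
  rw [midFrame, (hasDerivAt_midSurface_fst κ n R z).deriv,
    (hasDerivAt_midSurface_snd κ n R z).deriv, det_colMatrix_unitNormal, isUnit_iff_ne_zero]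
  set α := 1 - κ * z.2 + 1 / 6 * κ * n ^ 2 * z.2 ^ 3
  set β := 1 - 1 / 2 * n ^ 2 * z.2 ^ 2
  intro h0
  have h := congrArg (· ^ 2) h0
  simp only [← real_inner_self_eq_norm_sq, inner_cross_cross] at h
  simp [inner_add_left, inner_add_right, inner_smul_left, inner_smul_right, inner_frame hR,
    -inner_self_eq_norm_sq_to_K] at h
  rcases h with h | h
  · exact h1.ne' h
  · nlinarith [mul_pos h2 h2, mul_self_nonneg (n * z.2)]

/-- The coercivity estimate sees `A₀` only through `A₀ᵀ A₀`, so this identity is all that is needed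
of the square root. -/
theorem cfc_sqrt_transpose_mul_self {F : Matrix (Fin 3) (Fin 3) ℝ} (hF : F.PosSemidef) :
    (cfc Real.sqrt F)ᵀ * cfc Real.sqrt F = F := by
  have hsa : IsSelfAdjoint F := hF.isHermitian
  have hs : IsSelfAdjoint (cfc Real.sqrt F) := cfc_predicate _ _
  have ht : (cfc Real.sqrt F)ᵀ = cfc Real.sqrt F := by
    have := hs.star_eq
    rwa [Matrix.star_eq_conjTranspose, Matrix.conjTranspose_eq_transpose_of_trivial] at this
  rw [ht, ← cfc_mul Real.sqrt Real.sqrt F]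
  have : (spectrum ℝ F).EqOn (fun x => √x * √x) id := by
    intro x hx
    obtain ⟨i, rfl⟩ := hF.isHermitian.spectrum_real_eq_range_eigenvalues ▸ hx
    exact Real.mul_self_sqrt (hF.eigenvalues_nonneg i)
  rw [cfc_congr this, cfc_id ℝ F]

theorem blockMetric_eq_diagonal (κ : ℝ) (z : ℝ × ℝ) :
    blockMetric κ z = Matrix.diagonal ![(1 - κ * z.2) ^ 2, 1, 1] := by
  ext i j
  fin_cases i <;> fin_cases j <;> simp [blockMetric, refMetric]

/-- The prestrain factors the three-dimensional metric. -/
theorem prestrain_transpose_mul_self {w : ℝ} {x : ℝ × ℝ}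
    (h : IsUnit (midFrame κ n R (x.1, w * x.2)).det) :
    (prestrain κ n R w x)ᵀ * prestrain κ n R w x = blockMetric κ (x.1, w * x.2) := by
  have hD : (blockMetric κ (x.1, w * x.2)).PosSemidef := by
    rw [blockMetric_eq_diagonal]
    refine Matrix.PosSemidef.diagonal fun i => ?_
    fin_cases i <;> simp [sq_nonneg]
  have hF : (prestrainSq κ n R w x).PosSemidef := by
    have := hD.conjTranspose_mul_mul_same (midFrame κ n R (x.1, w * x.2))⁻¹
    rwa [Matrix.conjTranspose_eq_transpose_of_trivial] at this
  set M := midFrame κ n R (x.1, w * x.2) with hM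
  have e1 : M⁻¹ * M = 1 := Matrix.nonsing_inv_mul M h
  have e2 : Mᵀ * (M⁻¹)ᵀ = 1 := by rw [← Matrix.transpose_mul, e1, Matrix.transpose_one]
  calc (prestrain κ n R w x)ᵀ * prestrain κ n R w x
      = Mᵀ * ((cfc Real.sqrt (prestrainSq κ n R w x))ᵀ * cfc Real.sqrt (prestrainSq κ n R w x))
          * M := by
        rw [prestrain, Matrix.transpose_mul]
        simp only [Matrix.mul_assoc, hM]
    _ = (Mᵀ * (M⁻¹)ᵀ) * blockMetric κ (x.1, w * x.2) * (M⁻¹ * M) := by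
        rw [cfc_sqrt_transpose_mul_self hF, prestrainSq]
        simp only [Matrix.mul_assoc, hM]
    _ = _ := by rw [e1, e2, one_mul, mul_one]

end Prestrain

/-! ### Coercivity of the plate form -/

section PlateForm

attribute [local instance] Matrix.frobeniusNormedAddCommGroup Matrix.frobeniusNormedSpace

/-- Coercivity of the plate form on symmetric matrices. -/
theorem IsEnergyDensity.exists_le_plateForm {𝒲 : Matrix (Fin 3) (Fin 3) ℝ → ℝ≥0∞}
    (h : IsEnergyDensity 𝒲) (κ n : ℝ) {R : Matrix (Fin 3) (Fin 3) ℝ} (hR : R ∈ rotations) :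
    ∃ c : ℝ, 0 < c ∧ ∃ δ : ℝ, 0 < δ ∧ ∀ (w : ℝ) (x : ℝ × ℝ), |w * x.2| < δ →
      ∀ F : Matrix (Fin 2) (Fin 2) ℝ, Fᵀ = F →
        c * ∑ i, ∑ j, F i j ^ 2 ≤ plateForm 𝒲 κ n R w x F := by
  obtain ⟨c, hc, hQ⟩ := h.exists_le_Q3
  -- The first two conditions make the mid-surface frame invertible, the third makes `A₀`
  -- invertible, and the last two give `‖A₀‖² = (1 - κ t)² + 2 ≤ 6`.
  have ev : ∀ᶠ t : ℝ in 𝓝 0, 0 < 1 - κ * t + 1 / 6 * κ * n ^ 2 * t ^ 3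
      ∧ 0 < 1 - 1 / 2 * n ^ 2 * t ^ 2 ∧ 0 < 1 - κ * t ∧ 1 - κ * t < 2 := by
    have c1 : Continuous fun t : ℝ => 1 - κ * t + 1 / 6 * κ * n ^ 2 * t ^ 3 := by fun_prop
    have c2 : Continuous fun t : ℝ => 1 - 1 / 2 * n ^ 2 * t ^ 2 := by fun_prop
    have c3 : Continuous fun t : ℝ => 1 - κ * t := by fun_prop
    have h1 := (c1.tendsto 0).eventually (lt_mem_nhds (a := 0) (by norm_num))
    have h2 := (c2.tendsto 0).eventually (lt_mem_nhds (a := 0) (by norm_num))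
    have h3 := (c3.tendsto 0).eventually (lt_mem_nhds (a := 0) (by norm_num))
    have h4 := (c3.tendsto 0).eventually_lt_const (u := 2) (by norm_num)
    filter_upwards [h1, h2, h3, h4] with t a1 a2 a3 a4 using ⟨a1, a2, a3, a4⟩
  obtain ⟨δ, hδ, hδ'⟩ := Metric.eventually_nhds_iff.1 ev
  -- The `9` is `36 / 4`: `36` is the square of the bound `6` for `‖A₀‖²`, and `4` comes from `F +
  -- Fᵀ = 2F`.
  refine ⟨c / 9, by positivity, δ, hδ, fun w x hx F hF => ?_⟩
  obtain ⟨a1, a2, a3, a4⟩ := hδ' (y := w * x.2) (by simpa [dist_eq_norm] using hx)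
  have hM : IsUnit (midFrame κ n R (x.1, w * x.2)).det := isUnit_det_midFrame hR a1 a2
  have hAA := prestrain_transpose_mul_self (κ := κ) (n := n) (R := R) hM
  set A := prestrain κ n R w x with hA
  have hdet : IsUnit A.det := by
    have := congrArg Matrix.det hAA
    rw [Matrix.det_mul, Matrix.det_transpose, blockMetric_eq_diagonal, Matrix.det_diagonal,
      Fin.prod_univ_three] at this
    simp at this
    rw [isUnit_iff_ne_zero]
    intro h0
    rw [h0] at this
    have : 0 < (1 - κ * (w * x.2)) ^ 2 := by positivity
    linarith
  have hnorm : ‖A‖ ^ 2 ≤ 6 := by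
    rw [frobenius_norm_sq_eq_trace, hAA, blockMetric_eq_diagonal, Matrix.trace_diagonal,
      Fin.sum_univ_three]
    simp
    nlinarith
  refine le_csInf ?_ ?_
  -- Bounding a real `sInf` from below requires a competitor; the extension of `F` by zero is one.
  · refine Set.Nonempty.image _ ⟨!![F 0 0, F 0 1, 0; F 1 0, F 1 1, 0; 0, 0, 0], ?_⟩
    ext i j
    fin_cases i <;> fin_cases j <;> rfl
  · rintro _ ⟨G, hG, rfl⟩
    have hG' : G.submatrix Fin.castSucc Fin.castSucc = F := hG
    have e1 : ‖F + Fᵀ‖ ≤ ‖G + Gᵀ‖ := by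
      have := norm_submatrix_castSucc_le (G + Gᵀ)
      rwa [Matrix.submatrix_add, Pi.add_apply, Pi.add_apply, ← Matrix.transpose_submatrix, hG']
        at this
    have e2 := e1.trans (norm_symm_le_of_congr (G := G) hdet)
    have e3 : ‖F + Fᵀ‖ ^ 2 = 4 * ∑ i, ∑ j, F i j ^ 2 := by
      rw [hF, ← two_smul ℝ F, norm_smul, mul_pow, frobenius_norm_sq]
      norm_num
    set H := (A⁻¹)ᵀ * G * A⁻¹ + ((A⁻¹)ᵀ * G * A⁻¹)ᵀ
    have e4 : ‖F + Fᵀ‖ ^ 2 ≤ 36 * ‖H‖ ^ 2 := by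
      calc ‖F + Fᵀ‖ ^ 2 ≤ (6 * ‖H‖) ^ 2 := by
            gcongr
            exact e2.trans (by gcongr)
        _ = _ := by ring
    have e5 := hQ ((A⁻¹)ᵀ * G * A⁻¹)
    calc c / 9 * ∑ i, ∑ j, F i j ^ 2 ≤ c * ‖H‖ ^ 2 := by
          have : ∑ i, ∑ j, F i j ^ 2 ≤ 9 * ‖H‖ ^ 2 := by linarith
          calc _ ≤ c / 9 * (9 * ‖H‖ ^ 2) := by gcongr
            _ = _ := by ring
      _ ≤ _ := e5

end PlateForm

/-! ### Incompatibility and the energy bound -/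

section Main

/-- The flat geometry with `II = diag(0, n)` is Codazzi-incompatible. -/
theorem codazziIncompatible_refSecond {L κ n : ℝ} (hL : 0 < L) (hκ : κ ≠ 0) (hn : n ≠ 0) :
    CodazziIncompatible L (fun _ => κ) (refMetric κ) (refSecond n) := by
  constructor
  · intro s _
    -- Near the midline `1 - κ t` is positive, so the square root is affine and the curvature is
    -- zero.
    have hsqrt : (fun t => √(refMetric κ (s, t) 0 0)) =ᶠ[𝓝 0] fun t => 1 - κ * t := by
      have hc : Continuous fun t : ℝ => 1 - κ * t := by fun_prop
      filter_upwards [(hc.tendsto 0).eventually_const_lt (u := 0) (by norm_num)] with t ht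
      simp [refMetric, Real.sqrt_sq ht.le]
    have h2 : iteratedDeriv 2 (fun t => √(refMetric κ (s, t) 0 0)) 0 = 0 := by
      rw [hsqrt.iteratedDeriv_eq 2, iteratedDeriv_succ, iteratedDeriv_one]
      have : deriv (fun t : ℝ => 1 - κ * t) = fun _ => -κ := by
        ext t
        simp
      rw [this]
      simp
    simp [gaussDeficit, gaussCurvature, h2, refSecond]
  · intro h
    have := congrFun (h 0 ⟨le_rfl, hL.le⟩) 0
    simp [codazziDeficit, refSecond, hκ, hn] at this

theorem exists_le_lintegral_deficit {L κ n : ℝ} (hL : 0 < L) (hκ : κ ≠ 0) (hn : n ≠ 0) :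
    ∃ c : ℝ, 0 < c ∧ ∃ w₀ : ℝ, 0 < w₀ ∧ ∀ w : ℝ, 0 < w → w < w₀ → ∀ f : W22 L,
      IsRescaledIsometry κ w f →
        ENNReal.ofReal (c * w) ≤ ∫⁻ x in strip L, ENNReal.ofReal (f.deficit w n x) := by
  obtain ⟨c, hc, w₀, hw₀, h⟩ := exists_le_integral_deficit hL hκ hn
  refine ⟨c, hc, w₀, hw₀, fun w hw hww f hf => ?_⟩
  rw [← ofReal_integral_eq_lintegral_ofReal (f.integrable_deficit w n)
    (Eventually.of_forall fun x => f.deficit_nonneg w n x)]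
  exact ENNReal.ofReal_le_ofReal (h w hw hww f hf)

/-- The plate energy of rescaled isometries is at least of the order of the width. -/
theorem exists_le_plateEnergy {L κ n : ℝ} (hL : 0 < L) (hκ : κ ≠ 0) (hn : n ≠ 0)
    {𝒲 : Matrix (Fin 3) (Fin 3) ℝ → ℝ≥0∞} (h𝒲 : IsEnergyDensity 𝒲)
    {R : Matrix (Fin 3) (Fin 3) ℝ} (hR : R ∈ rotations) :
    ∃ c : ℝ, 0 < c ∧ ∃ w₀ : ℝ, 0 < w₀ ∧ ∀ w : ℝ, 0 < w → w < w₀ → ∀ f : W22 L,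
      IsRescaledIsometry κ w f → ENNReal.ofReal (c * w) ≤ plateEnergy 𝒲 κ n R w f := by
  obtain ⟨c₁, hc₁, w₁, hw₁, h₁⟩ := exists_le_lintegral_deficit hL hκ hn
  obtain ⟨c₂, hc₂, δ, hδ, h₂⟩ := h𝒲.exists_le_plateForm κ n hR
  -- The factors are the prefactor of the energy, the average over a strip of area `L`, the
  -- coercivity constant of the plate form, and the deficit bound.
  refine ⟨1 / 12 * (L⁻¹ * (c₂ * c₁)), by positivity, min w₁ δ, by positivity,
    fun w hw hww f hf => ?_⟩
  have hpt : ∀ᵐ x ∂(volume.restrict (strip L)),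
      ENNReal.ofReal c₂ * ENNReal.ofReal (f.deficit w n x) ≤ ENNReal.ofReal
        (plateForm 𝒲 κ n R w x (f.secondForm w x - refSecond n (x.1, w * x.2))) := by
    filter_upwards [f.secondForm_symm (w := w), ae_restrict_mem (isOpen_strip L).measurableSet]
      with x hx hxs
    rw [← ENNReal.ofReal_mul hc₂.le]
    -- `refSecond` is constant in its point argument, so `II^w` and `II⁰` coincide and the plate
    -- form bounds the deficit itself.
    refine ENNReal.ofReal_le_ofReal
      (h₂ w x ?_ (f.secondForm w x - refSecond n (x.1, w * x.2)) ?_)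
    · have hy : |x.2| ≤ 1 := by
        have := hxs.2
        rw [abs_le]
        constructor <;> linarith [this.1, this.2]
      rw [abs_mul, abs_of_pos hw]
      calc w * |x.2| ≤ w := mul_le_of_le_one_right hw.le hy
        _ < δ := hww.trans_le (min_le_right _ _)
    · have h1 : (f.secondForm w x)ᵀ = f.secondForm w x := by
        ext i j
        fin_cases i <;> fin_cases j <;> simp [Matrix.transpose_apply, hx]
      have h2 : (refSecond n (x.1, w * x.2))ᵀ = refSecond n (x.1, w * x.2) := by
        ext i j
        fin_cases i <;> fin_cases j <;> rfl
      rw [Matrix.transpose_sub, h1, h2]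
  have hint : ENNReal.ofReal (c₂ * (c₁ * w)) ≤ ∫⁻ x in strip L, ENNReal.ofReal
      (plateForm 𝒲 κ n R w x (f.secondForm w x - refSecond n (x.1, w * x.2))) := by
    refine le_trans ?_ (lintegral_mono_ae hpt)
    rw [lintegral_const_mul' _ _ ENNReal.ofReal_ne_top, ENNReal.ofReal_mul hc₂.le]
    gcongr
    exact h₁ w hw (hww.trans_le (min_le_left _ _)) f hf
  rw [plateEnergy, setLAverage_eq, volume_strip]
  have e : ENNReal.ofReal (1 / 12 * (L⁻¹ * (c₂ * c₁)) * w)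
      = 1 / 12 * (ENNReal.ofReal (c₂ * (c₁ * w)) / ENNReal.ofReal L) := by
    have : 1 / 12 * (L⁻¹ * (c₂ * c₁)) * w = 12⁻¹ * (L⁻¹ * (c₂ * (c₁ * w))) := by ring
    rw [this, ENNReal.ofReal_mul (by norm_num), ENNReal.ofReal_mul (by positivity),
      ENNReal.ofReal_inv_of_pos hL, ENNReal.ofReal_inv_of_pos (by norm_num), one_div,
      ENNReal.div_eq_inv_mul]
    norm_num
  rw [e]
  gcongr

end Main
end Ribbon

/-! ### The limits as `w → 0` -/

open Ribbon
theorem mainTheorem11 (L κ n : ℝ) (hL : 0 < L) (hκ : κ ≠ 0) (hn : n ≠ 0)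
    (𝒲 : Matrix (Fin 3) (Fin 3) ℝ → ℝ≥0∞) (h𝒲 : IsEnergyDensity 𝒲)
    (R : Matrix (Fin 3) (Fin 3) ℝ) (hR : R ∈ rotations) :
    -- the geometry is Codazzi-incompatible, with `II₁₁ = 0` on the midline
    (CodazziIncompatible L (fun _ => κ) (refMetric κ) (refSecond n) ∧
      ∀ s ∈ Icc 0 L, refSecond n (s, 0) 0 0 = 0) ∧
    -- `lim_{w → 0} inf w^{-(1+ε)} Ẽ_w = ∞`
    (∀ ε : ℝ, 0 < ε →
      Tendsto (fun w : ℝ => ⨅ f ∈ {f : W22 L | IsRescaledIsometry κ w f},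
        plateEnergy 𝒲 κ n R w f / ENNReal.ofReal (w ^ (1 + ε))) (𝓝[>] 0) (𝓝 ⊤)) ∧
    -- `w^{(1+ε)/2} ≪ ‖II^w_{f_w} - II⁰‖` along every sequence of rescaled isometries
    (∀ (w : ℕ → ℝ) (f : ℕ → W22 L), (∀ k, 0 < w k) → Tendsto w atTop (𝓝 0) →
      (∀ k, IsRescaledIsometry κ (w k) (f k)) → ∀ ε : ℝ, 0 < ε →
      Tendsto (fun k => ENNReal.ofReal (w k ^ ((1 + ε) / 2)) / secondFormDist n (w k) (f k))
        atTop (𝓝 0)) := by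
  refine ⟨⟨codazziIncompatible_refSecond hL hκ hn, fun s _ => rfl⟩, fun ε hε => ?_,
    fun w f hw hw0 hf ε hε => ?_⟩
  · obtain ⟨c, hc, w₀, hw₀, h⟩ := exists_le_plateEnergy (n := n) hL hκ hn h𝒲 hR
    -- The energy bound `c w`, uniform in `f`, leaves `c w^{-ε}` after division by `w^{1+ε}`.
    have hlim : Tendsto (fun w : ℝ => ENNReal.ofReal (c * w ^ (-ε))) (𝓝[>] 0) (𝓝 ⊤) :=
      ENNReal.tendsto_ofReal_atTop.comp
        ((tendsto_rpow_neg_nhdsGT_zero (neg_lt_zero.2 hε)).const_mul_atTop hc)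
    refine tendsto_of_tendsto_of_tendsto_of_le_of_le' hlim tendsto_const_nhds ?_
      (Eventually.of_forall fun _ => le_top)
    filter_upwards [Ioo_mem_nhdsGT hw₀] with w hw
    refine le_iInf₂ fun f hf => ?_
    have hpos : 0 < w ^ (1 + ε) := Real.rpow_pos_of_pos hw.1 _
    have e : c * w ^ (-ε) = c * w / w ^ (1 + ε) := by
      rw [Real.rpow_add hw.1, Real.rpow_one, Real.rpow_neg hw.1.le]
      have := Real.rpow_pos_of_pos hw.1 ε
      have := hw.1
      field_simp
    rw [e, ENNReal.ofReal_div_of_pos hpos]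
    exact ENNReal.div_le_div_right (h w hw.1 hw.2 f hf) _
  · obtain ⟨c, hc, w₀, hw₀, h⟩ := exists_le_lintegral_deficit hL hκ hn
    have hlim : Tendsto (fun k => ENNReal.ofReal (w k ^ (ε / 2) / √c)) atTop (𝓝 0) := by
      have h1 : Tendsto (fun k => w k ^ (ε / 2) / √c) atTop (𝓝 0) := by
        have := (hw0.rpow_const (p := ε / 2) (Or.inr (by positivity))).div_const (√c)
        rwa [Real.zero_rpow (by positivity), zero_div] at this
      simpa [Function.comp_def] using (ENNReal.continuous_ofReal.tendsto 0).comp h1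
    refine tendsto_of_tendsto_of_tendsto_of_le_of_le' tendsto_const_nhds hlim
      (Eventually.of_forall fun _ => zero_le) ?_
    filter_upwards [hw0.eventually_lt_const hw₀] with k hk
    have hwk := hw k
    -- `secondFormDist` is the square root of the integrated deficit, so the bound `c w` becomes
    -- `√(c w)` and the quotient is at most `w^{ε/2} / √c`.
    have hle : ENNReal.ofReal (√(c * w k)) ≤ secondFormDist n (w k) (f k) := by
      rw [Real.sqrt_eq_rpow, ← ENNReal.ofReal_rpow_of_nonneg (by positivity) (by norm_num)]
      exact ENNReal.rpow_le_rpow (h (w k) hwk hk (f k) (hf k)) (by norm_num)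
    have hpos : 0 < √(c * w k) := Real.sqrt_pos.2 (by positivity)
    have e : w k ^ (ε / 2) / √c = w k ^ ((1 + ε) / 2) / √(c * w k) := by
      rw [add_div, Real.rpow_add hwk, Real.sqrt_mul hc.le, ← Real.sqrt_eq_rpow]
      have := Real.sqrt_pos.2 hwk
      have := Real.sqrt_pos.2 hc
      field_simp
    rw [e, ENNReal.ofReal_div_of_pos hpos]
    exact ENNReal.div_le_div_left hle _
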